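/- Let $m,n\ge 0$, $N=2n+1$, let $e_{ab}$ be the matrix units of size $2m+N$, and let $J=J(\lambda)=\mathrm{diag}(0_{2m},\,b+\lambda e_{1,N})$ with $b=\sum_{i=1}^{2n}e_{i+1,i}$. Let $C=\mathrm{diag}(\alpha,\beta)$, $\alpha=\sum_{i=1}^{2m}e_{i,2m+1-i}$, $\beta=\sum_{i=1}^{N}(-1)^{n+i-1}e_{i,N+1-i}$, and call a loop $g(\lambda)$ (a matrix with entries in $\mathbb C((\lambda^{-1}))$, possibly depending on $t$) twisted if $g(\lambda)\,C\,g(-\lambda)^{t}C^{-1}=1$. Let $G_-$ be the group of twisted loops $1+\sum_{i<0}g_i\lambda^i$ with determinant $1$, and $G_+$ the group of twisted invertible loops $\sum_{i\ge0}g_i\lambda^i$. All functions of the times $t=(t_1,t_3,t_5,\dots)$ are formal power series in $t$, and $x=t_1$. For $\xi=\sum_i\xi_i\lambda^i$ put $\xi_+=\sum_{i\ge0}\xi_i\lambda^i$. *Tau function.* Let $w(\xi,\eta)=\operatorname{Res}_\lambda\operatorname{tr}(\xi_\lambda\eta)$ (the coefficient of $\lambda^{-1}$), and let $S$ be the natural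 lift of $G_\pm$ to the central extension of the loop group with Lie algebra cocycle $w$. For $f\in G_-$ (independent of $t$) let $W(t)=\exp\bigl(-\sum_{k\ge0}t_{2k+1}J^{2k+1}\bigr)$, $W(t)f^{-1}=M(t)^{-1}E(t)$ with $M(t)\in G_-$, $E(t)\in G_+$; then $\tau_f$ is defined by $S(W)S(f^{-1})=\tau_f\,S(M^{-1})S(E)$. *Hierarchy.* Let $V_{m,n}$ be the space of matrices $u=\sum_{i=1}^m q_i\mu_i+\sum_{i=1}^m r_{m+1-i}\nu_i+\sum_{i=1}^n u_i\omega_i$, where $\mu_i=e_{i,2m+N}+(-1)^{n+1}e_{2m+1,2m+1-i}$, $\nu_i=(-1)^n e_{m+i,2m+N}-e_{2m+1,m+1-i}$, $\omega_i=-e_{2m+n+1-i,2m+n+i}-e_{2m+n+2-i,2m+n+1+i}$. A gauge matrix is $\Delta=\mathrm{diag}(1_{2m},\Delta_{22})$ with $\Delta_{22}$ independent of $\lambda$ and upper triangular with ones on the diagonal. Let $S(u,\lambda)$ be the solution of $[\partial_x+J+u,S]=0$ that is conjugate to $J$ by a product $\Delta g$ of a gauge matrix and some $g\in G_-$, and let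 $S_{2j-1,0}(u)$ be the coefficient of $\lambda^0$ in $S(u,\lambda)^{2j-1}$. The matrix constrained CKP hierarchy is $$u_{t_{2j-1}}=[\partial_x+\mathrm{diag}(0_{2m},b)+u,\;S_{2j-1,0}(u)+\eta_{2j-1}(u)],\qquad j=1,2,\dots,$$ where $\eta_{2j-1}(u)=\mathrm{diag}(0_{2m},\text{strictly upper triangular})$ is such that the right-hand side lies in $V_{m,n}$. *Theorem.* There are differential polynomials $R_1,\dots,R_n$ and $K_1,K_2,\dots$ over $\mathbb C$ (in $x$-derivatives), depending only on $m,n$, such that $R_j$ is a polynomial in $u_1,\dots,u_{j-1}$ and their $x$-derivatives; $K_j$ is a polynomial in the $q_i$, $r_i$, $u_i$ and their $x$-derivatives, in which the derivatives of the $q_i$ and $r_i$ have order at most $2(j-1)$; $K_1$ does not involve the $u_i$; and the following holds. Let $f\in G_-$, with $M$, $E$, $\tau_f$ as above, and let $u$ be the solution of the matrix constrained CKP hierarchy attached to $f$, i.e. $\Delta(\partial_x+(MJM^{-1})_+)\Delta^{-1}=\partial_x+J+u$ for a gauge matrix $\Delta(t)$ and $u(t)\in V_{m,n}$. Then $$(\ln\tau_f)_{t_1t_{2j-1}}=\frac{2(2j-1)}{2n+1}\,u_j+R_j\quad(j=1,\dots,n),\qquad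 (\ln\tau_f)_{t_1t_{2n+2j-1}}=K_j\quad(j=1,2,\dots).$$ -/

import Mathlib

open Matrix

namespace CCKP

noncomputable section

/-! ### Formal functions of the times and formal loops

The times are `t₁, t₃, t₅, …`; the index `k : ℕ` stands for `t_{2k+1}`, and `x = t₁` has index `0`.
Laurent series are series in `λ⁻¹`: the exponent `e` of a Mathlib `LaurentSeries` stands for `λ^(-e)`,
so an element of `LaurentSeries ℂ` is `∑_{i ≤ i₀} c_i λ^i`. -/

/-- Formal functions of `t = (t₁, t₃, …)`. -/
abbrev Fun : Type := MvPowerSeries ℕ ℂ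

/-- Formal functions of `t` with values in `ℂ((λ⁻¹))`. -/
abbrev LFun : Type := MvPowerSeries ℕ (LaurentSeries ℂ)

/-- `∂/∂t_{2k+1}` on formal functions. -/
def dt (k : ℕ) (a : Fun) : Fun := MvPowerSeries.pderiv ℂ k a

/-- `∂/∂t_{2k+1}` on formal loop functions. -/
def dtL (k : ℕ) (a : LFun) : LFun := MvPowerSeries.pderiv (LaurentSeries ℂ) k a

/-- The spectral parameter `λ`. -/
def lam : LaurentSeries ℂ := HahnSeries.single (-1) 1

/-- `∂_λ = - z² ∂_z` for `z = λ⁻¹`. -/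
def dLam₀ (h : LaurentSeries ℂ) : LaurentSeries ℂ :=
  -(HahnSeries.single (2 : ℤ) (1 : ℂ) * LaurentSeries.hasseDeriv ℂ 1 h)

/-- `h(λ) ↦ h(-λ)`. -/
def flip₀ (h : LaurentSeries ℂ) : LaurentSeries ℂ where
  coeff e := (e.negOnePow : ℤ) * h.coeff e
  isPWO_support' := h.isPWO_support.mono (by
    intro e he hc
    exact he (by simp [hc]))

/-- `∂_λ`, coefficientwise in `t`. -/
def dLam (a : LFun) : LFun := fun α => dLam₀ (MvPowerSeries.coeff α a)

/-- `λ ↦ -λ`, coefficientwise in `t`. -/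
def flip (a : LFun) : LFun := fun α => flip₀ (MvPowerSeries.coeff α a)

/-- The part `∑_{i ≥ 0} a_i λ^i`. -/
def plus (a : LFun) : LFun := fun α => HahnSeries.truncLT (1 : ℤ) (MvPowerSeries.coeff α a)

/-- The coefficient of `λ^i`. -/
def coeffLam (i : ℤ) (a : LFun) : Fun := fun α => (MvPowerSeries.coeff α a).coeff (-i)

/-- Functions of `t` as loop functions that do not depend on `λ`. -/
def ofFun : Fun →+* LFun := MvPowerSeries.map HahnSeries.C

/-- Loops as loop functions that do not depend on `t`. -/
def ofLoop : LaurentSeries ℂ →+* LFun := MvPowerSeries.C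

/-! ### Matrices of size `2m+2n+1` -/

/-- The indices `i` and `m+i` (`1 ≤ i ≤ m`) and `2m+a` (`1 ≤ a ≤ 2n+1`), in this order. -/
abbrev Idx (m n : ℕ) : Type := (Fin m ⊕ Fin m) ⊕ Fin (2 * n + 1)

abbrev Mat (m n : ℕ) (R : Type) : Type := Matrix (Idx m n) (Idx m n) R

variable {m n : ℕ}

/-- `C_{m,n} = diag(α_m, β_n)`, with `C_{m,n}² = 1`. -/
def twistC (m n : ℕ) : Mat m n LFun :=
  fromBlocks
    (∑ i : Fin m, (single (Sum.inl i) (Sum.inr i.rev) 1 + single (Sum.inr i) (Sum.inl i.rev) 1))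
    0 0
    (∑ a : Fin (2 * n + 1), single a a.rev ((-1) ^ (n + (a : ℕ))))

/-- `diag(0_{2m}, b)` with `b = ∑ e_{i+1,i}`. -/
def bMat (m n : ℕ) (R : Type) [CommRing R] : Mat m n R :=
  fromBlocks 0 0 0 (∑ i : Fin (2 * n), single i.succ i.castSucc 1)

/-- `J(λ) = diag(0_{2m}, e_{1,2n+1} λ + b)`. -/
def J (m n : ℕ) : Mat m n (LaurentSeries ℂ) :=
  single (Sum.inr 0) (Sum.inr (Fin.last _)) lam + bMat m n (LaurentSeries ℂ)

/-- `J` as a loop function. -/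
def JL (m n : ℕ) : Mat m n LFun := (J m n).map ofLoop

/-- The symmetry condition `σ(g(-λ)) = g(λ)`, where `σ(Y) = (C Yᵗ C⁻¹)⁻¹` and `C⁻¹ = C`. -/
def Twisted (g : Mat m n LFun) : Prop :=
  g * (twistC m n * (g.map flip)ᵀ * twistC m n) = 1

/-- Formal functions with values in the negative loop group: `g = 1 + ∑_{i<0} g_i λ^i`. -/
structure InMinus (g : Mat m n LFun) : Prop where
  plus_eq : g.map plus = 1
  det_eq : g.det = 1
  twisted : Twisted g

/-- Formal functions with values in the positive loop group. As some of the `J^{2i-1}` have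
nonzero trace, the determinant is only required to be invertible. -/
structure InPlus (g : Mat m n LFun) : Prop where
  plus_eq : g.map plus = g
  isUnit_det : IsUnit g.det
  twisted : Twisted g

/-- `W(t) = exp(-∑_k t_{2k+1} J^{2k+1})`: the coefficient of `t^α` is
`(-1)^{|α|} / α! • J^{∑_k (2k+1) α_k}`. -/
def vacuum (m n : ℕ) : Mat m n LFun :=
  Matrix.of fun i j => fun α =>
    ((-1 : ℂ) ^ α.degree / (α.prod fun _ a => (a.factorial : ℂ))) •
      (J m n ^ (α.sum fun k a => (2 * k + 1) * a)) i j

/-! ### The central extension and the tau function -/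

/-- `⟨ξ, η⟩_{-1} = ∑_j tr(ξ_j η_{-j-1})`. -/
def pairing (ξ η : Mat m n LFun) : Fun := coeffLam (-1) (trace (ξ * η))

/-- The 2-cocycle `w(ξ, η) = ⟨ξ_λ, η⟩_{-1}`. -/
def cocycle (ξ η : Mat m n LFun) : Fun := pairing (ξ.map dLam) η

/-- The central extension of the loop algebra, with coefficients in the formal functions. -/
@[ext] structure ExtAlg (m n : ℕ) where
  loop : Mat m n LFun
  central : Fun

/-- The bracket `[(ξ, a), (η, b)] = ([ξ, η], w(ξ, η))`. -/
def ExtAlg.bracket (X Y : ExtAlg m n) : ExtAlg m n :=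
  ⟨X.loop * Y.loop - Y.loop * X.loop, cocycle X.loop Y.loop⟩

/-- The adjoint action of the loop group on the extended algebra; its derivative at the identity in
the direction `ζ` is `X ↦ [(ζ, 0), X]`. -/
def ExtAlg.Ad (g : Mat m n LFun) (X : ExtAlg m n) : ExtAlg m n :=
  ⟨g * X.loop * g⁻¹, X.central + pairing (g⁻¹ * g.map dLam) X.loop⟩

/-- A formal function `g̃` of `t` with values in the central extension of the loop group and with
`g̃(0) = c • S(g(0))`, `g(0)` in the negative group. It is recorded by its projection `g`, by `c`,
and by the central components of its logarithmic derivatives `(∂_{t_{2k+1}} g̃) g̃⁻¹`, which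
are functions with values in the extended algebra. -/
@[ext] structure ExtLoop (m n : ℕ) where
  loop : Mat m n LFun
  base : ℂ
  conn : ℕ → Fun

/-- The logarithmic derivative `(∂_{t_{2k+1}} g̃) g̃⁻¹`. -/
def ExtLoop.logDeriv (X : ExtLoop m n) (k : ℕ) : ExtAlg m n :=
  ⟨X.loop.map (dtL k) * X.loop⁻¹, X.conn k⟩

/-- The product: `∂(g̃ h̃) (g̃ h̃)⁻¹ = (∂ g̃) g̃⁻¹ + Ad(g) ((∂ h̃) h̃⁻¹)`. -/
def ExtLoop.mul (X Y : ExtLoop m n) : ExtLoop m n :=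
  ⟨X.loop * Y.loop, X.base * Y.base,
    fun k => (X.logDeriv k).central + (ExtAlg.Ad X.loop (Y.logDeriv k)).central⟩

/-- The nowhere vanishing function `τ` as a function with values in the centre. -/
def ExtLoop.scalar (m n : ℕ) (τ : Fun) : ExtLoop m n :=
  ⟨1, MvPowerSeries.constantCoeff τ, fun k => dt k τ * τ⁻¹⟩

/-- The natural lift `S` of the positive and of the negative group, on which the cocycle vanishes. -/
def ExtLoop.lift (g : Mat m n LFun) : ExtLoop m n := ⟨g, 1, 0⟩

/-- `W f⁻¹ = M⁻¹ E` with `M` negative and `E` positive, and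
`S(W) S(f⁻¹) = τ S(M⁻¹) S(E)` in the central extension. -/
structure IsTau (f : Mat m n (LaurentSeries ℂ)) (M E : Mat m n LFun) (τ : Fun) : Prop where
  f_mem : InMinus (f.map ofLoop)
  M_mem : InMinus M
  E_mem : InPlus E
  factor : vacuum m n * (f.map ofLoop)⁻¹ = M⁻¹ * E
  lift_eq : (ExtLoop.lift (vacuum m n)).mul (ExtLoop.lift (f.map ofLoop)⁻¹) =
    ((ExtLoop.scalar m n τ).mul (ExtLoop.lift M⁻¹)).mul (ExtLoop.lift E)

/-- `(ln τ)_{t_{2i+1} t_{2k+1}}`. -/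
def logTau₂ (τ : Fun) (i k : ℕ) : Fun := dt i (dt k τ * τ⁻¹)

/-! ### The matrix constrained CKP hierarchy -/

/-- The coordinates `q_1,…,q_m`, `r_1,…,r_m`, `u_1,…,u_n` on `V_{m,n}`, as functions of `t`. -/
structure Fields (m n : ℕ) where
  q : Fin m → Fun
  r : Fin m → Fun
  u : Fin n → Fun

/-- `μ_i = e_{i,2m+2n+1} + (-1)^{n+1} e_{2m+1,2m+1-i}`. -/
def mu (i : Fin m) : Mat m n Fun :=
  single (Sum.inl (Sum.inl i)) (Sum.inr (Fin.last _)) 1 +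
    single (Sum.inr 0) (Sum.inl (Sum.inr i.rev)) ((-1) ^ (n + 1))

/-- `ν_i = (-1)^n e_{m+i,2m+2n+1} - e_{2m+1,m+1-i}`. -/
def nu (i : Fin m) : Mat m n Fun :=
  single (Sum.inl (Sum.inr i)) (Sum.inr (Fin.last _)) ((-1) ^ n) -
    single (Sum.inr 0) (Sum.inl (Sum.inl i.rev)) 1

/-- `ω_i = - e_{2m+n+1-i,2m+n+i} - e_{2m+n+2-i,2m+n+1+i}`, where `i = k + 1`. -/
def omega (k : Fin n) : Mat m n Fun :=
  -single (Sum.inr ⟨n - 1 - k, by omega⟩) (Sum.inr ⟨n + k, by omega⟩) 1 -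
    single (Sum.inr ⟨n - k, by omega⟩) (Sum.inr ⟨n + k + 1, by omega⟩) 1

/-- `u = ∑ q_i μ_i + ∑ r_{m+1-i} ν_i + ∑ u_i ω_i`. -/
def Fields.toMat (v : Fields m n) : Mat m n Fun :=
  ∑ i, v.q i • mu i + ∑ i, v.r (Fin.rev i) • nu i + ∑ k, v.u k • omega k

/-- `diag(1, Δ₂₂)` with `Δ₂₂` upper triangular with ones on the diagonal. -/
def IsGauge (Δ : Mat m n Fun) : Prop :=
  ∃ D : Matrix (Fin (2 * n + 1)) (Fin (2 * n + 1)) Fun,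
    Δ = fromBlocks 1 0 0 D ∧ (∀ a, D a a = 1) ∧ ∀ a b, b < a → D a b = 0

/-- `diag(0, η₂₂)` with `η₂₂` strictly upper triangular. -/
def IsStrictUpper (η : Mat m n Fun) : Prop :=
  ∃ D : Matrix (Fin (2 * n + 1)) (Fin (2 * n + 1)) Fun,
    η = fromBlocks 0 0 0 D ∧ ∀ a b, b ≤ a → D a b = 0

/-- `S = S(u, λ)`: `[∂_x + J + u, S] = 0`, and `S` is conjugate to `J` by `Δ g` with `Δ` a gauge
matrix and `g` in the negative group (`S(u, λ) = Δ S(q, λ) Δ⁻¹` for `u = Δ * q`). -/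
def IsResolvent (v : Fields m n) (S : Mat m n LFun) : Prop :=
  S.map (dtL 0) + (JL m n + v.toMat.map ofFun) * S - S * (JL m n + v.toMat.map ofFun) = 0 ∧
  ∃ (Δ : Mat m n Fun) (g : Mat m n LFun), IsGauge Δ ∧ InMinus g ∧
    S = (Δ.map ofFun * g) * JL m n * (Δ.map ofFun * g)⁻¹

/-- `u` solves all flows
`u_{t_{2k+1}} = [∂_x + diag(0, b) + u, S_{2k+1,0}(u) + η_{2k+1}(u)]`, `x = t₁`. -/
def IsSolution (v : Fields m n) : Prop :=
  ∃ (S : Mat m n LFun) (η : ℕ → Mat m n Fun), IsResolvent v S ∧ ∀ k,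
    IsStrictUpper (η k) ∧
    v.toMat.map (dt k) =
      ((S ^ (2 * k + 1)).map (coeffLam 0) + η k).map (dt 0)
      + (bMat m n Fun + v.toMat) * ((S ^ (2 * k + 1)).map (coeffLam 0) + η k)
      - ((S ^ (2 * k + 1)).map (coeffLam 0) + η k) * (bMat m n Fun + v.toMat)

/-- `u` is the formal inverse scattering solution attached to `f`, where `M` is the negative factor
of `W f⁻¹`: `u = Δ * q`, that is `Δ (∂_x + J + q) Δ⁻¹ = ∂_x + J + u`, for `J + q = (M J M⁻¹)_+`. -/
def IsAttached (M : Mat m n LFun) (v : Fields m n) : Prop :=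
  ∃ Δ : Mat m n Fun, IsGauge Δ ∧
    Δ.map ofFun * (M * JL m n * M⁻¹).map plus - (Δ.map ofFun).map (dtL 0) =
      (JL m n + v.toMat.map ofFun) * Δ.map ofFun

/-! ### Differential polynomials -/

/-- The letters `∂_x^k q_i`, `∂_x^k r_i`, `∂_x^k u_i`, each written as a pair `(i, k)`. -/
inductive Letter (m n : ℕ) : Type
  | q (i : Fin m) (k : ℕ)
  | r (i : Fin m) (k : ℕ)
  | u (i : Fin n) (k : ℕ)

/-- The value of a letter on `v`. -/
def Letter.val (v : Fields m n) : Letter m n → Fun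
  | .q i k => (dt 0)^[k] (v.q i)
  | .r i k => (dt 0)^[k] (v.r i)
  | .u i k => (dt 0)^[k] (v.u i)

/-- The value of a differential polynomial on `v`. -/
def evalDiff (v : Fields m n) (P : MvPolynomial (Letter m n) ℂ) : Fun :=
  MvPolynomial.aeval (Letter.val v) P

/-- `P` is a polynomial in the `x`-derivatives of `u_1,…,u_{j-1}` (zero-based: `u_i`, `i < j`). -/
def InvolvesOnlyULt (j : ℕ) (P : MvPolynomial (Letter m n) ℂ) : Prop :=
  ∀ l ∈ P.vars, ∃ (i : Fin n) (k : ℕ), (i : ℕ) < j ∧ l = .u i k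

/-- The derivatives of the `q_i` and `r_i` in `P` have order at most `d`. -/
def QROrderLE (d : ℕ) (P : MvPolynomial (Letter m n) ℂ) : Prop :=
  ∀ l ∈ P.vars, ∀ i k, l = .q i k ∨ l = .r i k → k ≤ d

/-- `P` involves no `u_i`. -/
def InvolvesNoU (P : MvPolynomial (Letter m n) ℂ) : Prop :=
  ∀ l ∈ P.vars, ∀ i k, l ≠ .u i k

end

end CCKP

/-!
Since `W f⁻¹ = M⁻¹ E`, the polynomial part of `M J^{2k+1} M⁻¹` differs from this loop by the
logarithmic derivative of `M` in `t_{2k+1}`, and the cocycle defining `τ` yields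
`(ln τ)_{t₁ t_{2k+1}} = Res tr (((M J M⁻¹)₊)_λ M J^{2k+1} M⁻¹)`. As `J` is linear in `λ` and a gauge
transformation does not depend on `λ`, this is the coefficient of `λ⁻¹` of one corner entry of
`S^{2k+1}`, where `S` is the conjugate of `J` that commutes with `∂_x + J + u`.

Substitute `λ ↦ λ^N` and conjugate by the principal grading. Then `J` becomes `λ Λ` with `Λ` the
cyclic matrix, and `S` becomes `λ σ` for a power series `σ` in `X = λ⁻¹` with `σ ≡ Λ` modulo `X`,
`σ^{N+1} = σ` and `X σ' + [Λ + U, σ] = 0`. These equations make `σ` the fixed point of a contraction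
in the `X`-adic topology, hence its coefficients are universal differential polynomials. They are
homogeneous for the weights `n + 1`, `n + 1`, `2i`, `1` of `q_i`, `r_i`, `u_i` (`i ≥ 1`), `∂_x`, and
even in the `q_i` and `r_i` jointly. This bounds the orders of the derivatives and isolates the
linear occurrence of `u_j`, whose coefficient is the first order variation of `σ` at `u = 0`.

For `K_1`, the matrix `J^N` is `λ` times a projection, and the coefficient can be read off the
idempotent deforming this projection, where it is `2 ∑ q_i r_i`.
-/

namespace CCKP

noncomputable section

/-! ### A contraction with prescribed fixed point -/

section Telescoping

/-- The sum `∑_{i<n} xⁱ d yⁿ⁻¹⁻ⁱ`, the noncommutative analogue of `n xⁿ⁻¹ d`. -/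
def sandwichSum {A : Type*} [Semiring A] (x y d : A) (n : ℕ) : A :=
  ∑ i ∈ Finset.range n, x ^ i * d * y ^ (n - 1 - i)

variable {A : Type*} [Ring A]

lemma sandwichSum_succ (x y d : A) (n : ℕ) :
    sandwichSum x y d (n + 1) = sandwichSum x y d n * y + x ^ n * d := by
  simp only [sandwichSum, Finset.sum_range_succ, Finset.sum_mul, add_tsub_cancel_right, tsub_self,
    pow_zero, mul_one, mul_assoc, ← pow_succ]
  congr 1
  refine Finset.sum_congr rfl fun i hi => ?_
  rw [show n - 1 - i + 1 = n - i by have := Finset.mem_range.1 hi; omega]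

lemma sandwichSum_commutator (x y d : A) (n : ℕ) :
    sandwichSum x y (x * d - d * y) n = x ^ n * d - d * y ^ n := by
  induction n with
  | zero => simp [sandwichSum]
  | succ n ih => rw [sandwichSum_succ, ih, pow_succ, pow_succ]; noncomm_ring

lemma sandwichSum_sub (x y : A) (n : ℕ) : sandwichSum x y (x - y) n = x ^ n - y ^ n := by
  simpa using sandwichSum_commutator x y 1 n

/-- The part of `σ^(k+1)` of order at least two in `σ - Λ`. -/
def powRemainder (k : ℕ) (Λ σ : A) : A :=
  ∑ i ∈ Finset.range (k + 1), (σ ^ i - Λ ^ i) * (σ - Λ) * Λ ^ (k - i)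

lemma pow_succ_eq_add_powRemainder (k : ℕ) (Λ σ : A) :
    σ ^ (k + 1) = Λ ^ (k + 1) + sandwichSum Λ Λ (σ - Λ) (k + 1) + powRemainder k Λ σ := by
  have split : sandwichSum σ Λ (σ - Λ) (k + 1) =
      sandwichSum Λ Λ (σ - Λ) (k + 1) + powRemainder k Λ σ := by
    simp only [sandwichSum, powRemainder, ← Finset.sum_add_distrib, Nat.add_sub_cancel]
    exact Finset.sum_congr rfl fun i _ => by noncomm_ring
  rw [add_assoc, ← split, sandwichSum_sub, add_sub_cancel]

/-- The sum `∑_{i≤k} Λⁱ [Λᵏ⁻ⁱ, s]`, expressed through `κ = [Λ, s]`. -/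
def commutatorSum (k : ℕ) (Λ κ : A) : A :=
  ∑ i ∈ Finset.range (k + 1), Λ ^ i * sandwichSum Λ Λ κ (k - i)

lemma commutatorSum_sub (k : ℕ) (Λ κ κ' : A) :
    commutatorSum k Λ (κ - κ') = commutatorSum k Λ κ - commutatorSum k Λ κ' := by
  simp only [commutatorSum, sandwichSum, mul_sub, sub_mul, Finset.sum_sub_distrib]

lemma sandwichSum_eq_nsmul_sub_commutatorSum (k : ℕ) (Λ s : A) :
    sandwichSum Λ Λ s (k + 1) =
      (k + 1) • (Λ ^ k * s) - commutatorSum k Λ (Λ * s - s * Λ) := by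
  have const : (k + 1) • (Λ ^ k * s) = ∑ _i ∈ Finset.range (k + 1), Λ ^ k * s := by
    rw [Finset.sum_const, Finset.card_range]
  rw [const, commutatorSum, sandwichSum, ← Finset.sum_sub_distrib]
  refine Finset.sum_congr rfl fun i hi => ?_
  have hik : i + (k - i) = k := by have := Finset.mem_range.1 hi; omega
  rw [sandwichSum_commutator, mul_sub, ← mul_assoc, ← pow_add, hik, Nat.add_sub_cancel]
  simp only [mul_assoc, sub_sub_cancel]

lemma mul_sub_eq_of_pow_succ_eq_self {k : ℕ} {Λ σ : A} (hΛ : Λ ^ (k + 1) = Λ)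
    (hσ : σ ^ (k + 1) = σ) :
    ((k + 1) • Λ ^ k - 1) * (σ - Λ) =
      commutatorSum k Λ (Λ * σ - σ * Λ) - powRemainder k Λ σ := by
  have expansion := pow_succ_eq_add_powRemainder k Λ σ
  have hcomm : Λ * (σ - Λ) - (σ - Λ) * Λ = Λ * σ - σ * Λ := by noncomm_ring
  rw [hσ, hΛ, sandwichSum_eq_nsmul_sub_commutatorSum, hcomm] at expansion
  rw [sub_mul, one_mul, smul_mul_assoc]
  nth_rewrite 2 [expansion]
  abel

end Telescoping

lemma isIdempotentElem_pow {M : Type*} [Monoid M] {k : ℕ} (hk : k ≠ 0) {a : M}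
    (ha : a ^ (k + 1) = a) : IsIdempotentElem (a ^ k) := by
  obtain ⟨j, rfl⟩ := Nat.exists_eq_succ_of_ne_zero hk
  rw [IsIdempotentElem, ← pow_add, show j.succ + j.succ = (j.succ + 1) + j by omega, pow_add, ha,
    ← pow_succ']

lemma mul_eq_one_of_isIdempotentElem {K A : Type*} [Field K] [Ring A] [Algebra K A] {c : K}
    (hc : c ≠ 0) {e : A} (he : IsIdempotentElem e) :
    (c⁻¹ • e + e - 1) * ((c + 1) • e - 1) = 1 := by
  simp only [mul_sub, sub_mul, add_mul, mul_smul_comm, smul_mul_assoc, he.eq, mul_one, one_mul]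
  match_scalars
  · field_simp
    ring
  · field_simp

section Divisibility

/-- Every entry of the matrix is divisible by `x`. -/
def EntriesDvd {I J R : Type*} [Monoid R] (x : R) (A : Matrix I J R) : Prop := ∀ i j, x ∣ A i j

namespace EntriesDvd

variable {I J K R : Type*} [CommRing R] {x y : R}

lemma zero : EntriesDvd x (0 : Matrix I J R) := fun _ _ => dvd_zero x

lemma add {A B : Matrix I J R} (hA : EntriesDvd x A) (hB : EntriesDvd x B) :
    EntriesDvd x (A + B) := fun i j => dvd_add (hA i j) (hB i j)

lemma neg {A : Matrix I J R} (hA : EntriesDvd x A) : EntriesDvd x (-A) :=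
  fun i j => (hA i j).neg_right

lemma sub {A B : Matrix I J R} (hA : EntriesDvd x A) (hB : EntriesDvd x B) :
    EntriesDvd x (A - B) := fun i j => dvd_sub (hA i j) (hB i j)

lemma sum {ι : Type*} {s : Finset ι} {F : ι → Matrix I J R} (h : ∀ k ∈ s, EntriesDvd x (F k)) :
    EntriesDvd x (∑ k ∈ s, F k) := fun i j => by
  rw [Matrix.sum_apply]; exact Finset.dvd_sum fun k hk => h k hk i j

lemma smul (A : Matrix I J R) : EntriesDvd x (x • A) := fun i j => dvd_mul_right x (A i j)

lemma smul_mul {A : Matrix I J R} (hA : EntriesDvd x A) (y : R) : EntriesDvd (x * y) (y • A) :=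
  fun i j => by rw [mul_comm x]; exact mul_dvd_mul_left y (hA i j)

variable [Fintype J]

lemma mul {A : Matrix I J R} {B : Matrix J K R} (hA : EntriesDvd x A) (hB : EntriesDvd y B) :
    EntriesDvd (x * y) (A * B) :=
  fun i k => Finset.dvd_sum fun j _ => mul_dvd_mul (hA i j) (hB j k)

lemma mul_left {B : Matrix J K R} (hB : EntriesDvd x B) (A : Matrix I J R) :
    EntriesDvd x (A * B) := fun _ k => Finset.dvd_sum fun j _ => (hB j k).mul_left _

lemma mul_right {A : Matrix I J R} (hA : EntriesDvd x A) (B : Matrix J K R) :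
    EntriesDvd x (A * B) := fun i _ => Finset.dvd_sum fun j _ => (hA i j).mul_right _

variable [Fintype I] [DecidableEq I] {A B Λ : Matrix I I R}

lemma sandwichSum (h : EntriesDvd x A) (P Q : Matrix I I R) (n : ℕ) :
    EntriesDvd x (sandwichSum P Q A n) :=
  sum fun _ _ => (h.mul_left _).mul_right _

lemma commutatorSum (h : EntriesDvd x A) (k : ℕ) (Λ : Matrix I I R) :
    EntriesDvd x (commutatorSum k Λ A) :=
  sum fun _ _ => (h.sandwichSum _ _ _).mul_left _

lemma pow_sub_pow (h : EntriesDvd x (A - B)) (n : ℕ) : EntriesDvd x (A ^ n - B ^ n) := by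
  rw [← sandwichSum_sub]; exact h.sandwichSum _ _ _

lemma powRemainder (h : EntriesDvd x (A - Λ)) (k : ℕ) : EntriesDvd x (powRemainder k Λ A) :=
  sum fun _ _ => (h.mul_left _).mul_right _

lemma powRemainder_sub (hA : EntriesDvd x (A - Λ)) (hB : EntriesDvd x (B - Λ))
    (hAB : EntriesDvd y (A - B)) (k : ℕ) :
    EntriesDvd (y * x) (CCKP.powRemainder k Λ A - CCKP.powRemainder k Λ B) := by
  rw [CCKP.powRemainder, CCKP.powRemainder, ← Finset.sum_sub_distrib]
  refine sum fun i _ => ?_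
  have split : (A ^ i - Λ ^ i) * (A - Λ) * Λ ^ (k - i) - (B ^ i - Λ ^ i) * (B - Λ) * Λ ^ (k - i) =
      ((A ^ i - B ^ i) * (A - Λ) + (B ^ i - Λ ^ i) * (A - B)) * Λ ^ (k - i) := by noncomm_ring
  rw [split]
  refine mul_right (((hAB.pow_sub_pow i).mul hA).add ?_) _
  rw [mul_comm y]
  exact (hB.pow_sub_pow i).mul hAB

end EntriesDvd

end Divisibility

section Contraction

open PowerSeries

variable {I B : Type*} [CommRing B]

/-- A map of coefficients applied to a power series; an evolution derivation of `B` extends in this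
way to the series over `B`. -/
def coeffwise (D : B → B) (a : B⟦X⟧) : B⟦X⟧ := PowerSeries.mk fun i => D (coeff i a)

@[simp] lemma coeff_coeffwise (D : B → B) (a : B⟦X⟧) (i : ℕ) :
    coeff i (coeffwise D a) = D (coeff i a) := coeff_mk _ _

lemma EntriesDvd.coeff_eq {w : ℕ} {σ σ' : Matrix I I B⟦X⟧} (h : EntriesDvd (X ^ w) (σ - σ'))
    {i : ℕ} (hi : i < w) (a b : I) : coeff i (σ a b) = coeff i (σ' a b) := by
  have := X_pow_dvd_iff.1 (h a b) i hi
  rwa [Matrix.sub_apply, map_sub, sub_eq_zero] at this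

lemma EntriesDvd.map_coeffwise_sub {w : ℕ} {σ σ' : Matrix I I B⟦X⟧} (D : B → B)
    (h : EntriesDvd (X ^ w) (σ - σ')) :
    EntriesDvd (X ^ w) (σ.map (coeffwise D) - σ'.map (coeffwise D)) := fun a b =>
  X_pow_dvd_iff.2 fun i hi => by
    simp only [Matrix.sub_apply, Matrix.map_apply, map_sub, coeff_coeffwise, h.coeff_eq hi,
      sub_self]

variable [Fintype I] [DecidableEq I] [Algebra ℚ B]

/-- The contraction whose fixed points congruent to `Λ` modulo `X` are the solutions of
`X σ' + [Λ + U, σ] = 0`, `σ^(k+1) = σ`, where `Λ^(k+1) = Λ` and `X ∣ U`. The first factor inverts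
the derivative `(k+1) Λᵏ - 1` of `σ ↦ σ^(k+1) - σ` modulo commutators with `Λ`. -/
def step (k : ℕ) (D : B → B) (Λ U σ : Matrix I I B⟦X⟧) : Matrix I I B⟦X⟧ :=
  Λ + ((k : ℚ)⁻¹ • Λ ^ k + Λ ^ k - 1) *
    (commutatorSum k Λ (-((X : B⟦X⟧) • σ.map (coeffwise D) + (U * σ - σ * U)))
      - powRemainder k Λ σ)

lemma step_eq_self {k : ℕ} (hk : k ≠ 0) {D : B → B} {Λ U σ : Matrix I I B⟦X⟧}
    (hΛ : Λ ^ (k + 1) = Λ) (hσ : σ ^ (k + 1) = σ)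
    (hD : (X : B⟦X⟧) • σ.map (coeffwise D) + ((Λ + U) * σ - σ * (Λ + U)) = 0) :
    step k D Λ U σ = σ := by
  have hcomm : -((X : B⟦X⟧) • σ.map (coeffwise D) + (U * σ - σ * U)) = Λ * σ - σ * Λ := by
    rw [neg_eq_iff_add_eq_zero, ← hD]; noncomm_ring
  have hinv := mul_eq_one_of_isIdempotentElem (K := ℚ) (Nat.cast_ne_zero.2 hk)
    (isIdempotentElem_pow hk hΛ)
  rw [← Nat.cast_succ, Nat.cast_smul_eq_nsmul] at hinv
  rw [step, hcomm, ← mul_sub_eq_of_pow_succ_eq_self hΛ hσ, ← mul_assoc, hinv, one_mul,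
    add_sub_cancel]

lemma step_sub_step (k : ℕ) (D : B → B) (Λ U σ σ' : Matrix I I B⟦X⟧) :
    step k D Λ U σ - step k D Λ U σ' = ((k : ℚ)⁻¹ • Λ ^ k + Λ ^ k - 1) *
      (commutatorSum k Λ (-((X : B⟦X⟧) • (σ.map (coeffwise D) - σ'.map (coeffwise D)) +
        (U * (σ - σ') - (σ - σ') * U))) - (powRemainder k Λ σ - powRemainder k Λ σ')) := by
  have hlin : -((X : B⟦X⟧) • (σ.map (coeffwise D) - σ'.map (coeffwise D)) +
      (U * (σ - σ') - (σ - σ') * U)) =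
      -((X : B⟦X⟧) • σ.map (coeffwise D) + (U * σ - σ * U)) -
        -((X : B⟦X⟧) • σ'.map (coeffwise D) + (U * σ' - σ' * U)) := by
    rw [smul_sub]; noncomm_ring
  rw [hlin, commutatorSum_sub, step, step]
  noncomm_ring

namespace EntriesDvd

variable {k : ℕ} {D : B → B} {Λ U σ σ' : Matrix I I B⟦X⟧}

lemma step_sub_step {w : ℕ} (hU : EntriesDvd X U) (hσ : EntriesDvd X (σ - Λ))
    (hσ' : EntriesDvd X (σ' - Λ)) (h : EntriesDvd (X ^ w) (σ - σ')) :
    EntriesDvd (X ^ (w + 1)) (step k D Λ U σ - step k D Λ U σ') := by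
  have hUl : EntriesDvd (X ^ w * X) (U * (σ - σ')) := by rw [mul_comm]; exact hU.mul h
  rw [CCKP.step_sub_step, pow_succ]
  exact ((((h.map_coeffwise_sub D).smul_mul X).add (hUl.sub (h.mul hU))).neg.commutatorSum _ _
    |>.sub (hσ.powRemainder_sub hσ' h k)).mul_left _

lemma step_sub (hU : EntriesDvd X U) (hσ : EntriesDvd X (σ - Λ)) :
    EntriesDvd X (step k D Λ U σ - Λ) := by
  rw [step, add_sub_cancel_left]
  exact (((smul _).add ((hU.mul_right _).sub (hU.mul_left _))).neg.commutatorSum _ _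
    |>.sub (hσ.powRemainder k)).mul_left _

lemma iterate_step_sub (hU : EntriesDvd X U) (w : ℕ) :
    EntriesDvd X ((step k D Λ U)^[w] Λ - Λ) := by
  induction w with
  | zero => simpa using zero
  | succ w ih => rw [Function.iterate_succ_apply']; exact step_sub hU ih

lemma sub_iterate_step (hU : EntriesDvd X U) (hσ : EntriesDvd X (σ - Λ))
    (hfix : step k D Λ U σ = σ) (w : ℕ) :
    EntriesDvd (X ^ (w + 1)) (σ - (step k D Λ U)^[w] Λ) := by
  induction w with
  | zero => simpa using hσ
  | succ w ih =>
    rw [Function.iterate_succ_apply']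
    nth_rewrite 1 [← hfix]
    exact step_sub_step hU hσ (iterate_step_sub hU w) ih

end EntriesDvd

variable {B' : Type*} [CommRing B'] [Algebra ℚ B']

lemma map_step (φ : B →+* B') {D : B → B} {D' : B' → B'} (hD : ∀ a, φ (D a) = D' (φ a))
    (k : ℕ) (Λ U σ : Matrix I I B⟦X⟧) :
    (PowerSeries.map φ).mapMatrix (step k D Λ U σ) =
      step k D' ((PowerSeries.map φ).mapMatrix Λ) ((PowerSeries.map φ).mapMatrix U)
        ((PowerSeries.map φ).mapMatrix σ) := by
  set F := (PowerSeries.map φ).mapMatrix (m := I) with hF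
  have hX (A : Matrix I I B⟦X⟧) : F ((X : B⟦X⟧) • A) = (X : B'⟦X⟧) • F A := by
    ext a b i
    simp [hF]
  have hmap : F (σ.map (coeffwise D)) = (F σ).map (coeffwise D') := by
    ext a b i
    simp [hF, hD]
  simp only [step, commutatorSum, powRemainder, sandwichSum, map_add, map_sub, map_mul, map_neg,
    map_pow, map_sum, map_one, map_rat_smul, hX, hmap]

lemma map_iterate_step (φ : B →+* B') {D : B → B} {D' : B' → B'} (hD : ∀ a, φ (D a) = D' (φ a))
    (k : ℕ) (Λ U : Matrix I I B⟦X⟧) (w : ℕ) :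
    (PowerSeries.map φ).mapMatrix ((step k D Λ U)^[w] Λ) =
      (step k D' ((PowerSeries.map φ).mapMatrix Λ) ((PowerSeries.map φ).mapMatrix U))^[w]
        ((PowerSeries.map φ).mapMatrix Λ) :=
  Function.Semiconj.iterate_right (fun σ => map_step φ hD k Λ U σ) w Λ

end Contraction

/-! ### The cyclic matrix and the potential in the principal grading -/

section Cyclic

lemma circulant_single_one_pow {G R : Type*} [AddCommGroup G] [Fintype G] [DecidableEq G]
    [CommSemiring R] (g : G) (k : ℕ) :
    circulant (Pi.single g (1 : R)) ^ k = circulant (Pi.single (k • g) 1) := by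
  induction k with
  | zero => rw [pow_zero, zero_nsmul, ← circulant_single_one]
  | succ k ih =>
    rw [pow_succ, ih, circulant_mul, mulVec_single_one]
    congr 1
    ext i
    simp only [Matrix.col_apply, circulant_apply, Pi.single_apply, sub_eq_iff_eq_add, succ_nsmul]

lemma fromBlocks_zero_pow_succ {l o R : Type*} [Fintype l] [Fintype o] [DecidableEq l]
    [DecidableEq o] [Semiring R] (A : Matrix o o R) (k : ℕ) :
    (fromBlocks 0 0 0 A : Matrix (l ⊕ o) (l ⊕ o) R) ^ (k + 1) = fromBlocks 0 0 0 (A ^ (k + 1)) := by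
  induction k with
  | zero => simp only [zero_add, pow_one]
  | succ k ih => rw [pow_succ, ih, fromBlocks_multiply, pow_succ A (k + 1)]; simp

variable {m n : ℕ} {B : Type} [CommRing B]

/-- The cyclic matrix `Λ = diag(0, b + e_{1,N})`. -/
def cyc (m n : ℕ) (R : Type) [CommRing R] : Mat m n R :=
  fromBlocks 0 0 0 (circulant (Pi.single 1 1))

/-- The projection onto the second block. -/
def proj (m n : ℕ) (R : Type) [CommRing R] : Mat m n R := fromBlocks 0 0 0 1

lemma cyc_pow_succ (k : ℕ) :
    cyc m n B ^ (k + 1) = fromBlocks 0 0 0 (circulant (Pi.single ((k + 1) • 1) 1)) := by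
  rw [cyc, fromBlocks_zero_pow_succ, circulant_single_one_pow]

lemma succ_nsmul_fin (x : Fin (2 * n + 1)) : (2 * n + 1) • x = 0 := by
  simpa only [Fintype.card_fin] using card_nsmul_eq_zero (x := x)

lemma cyc_pow_card : cyc m n B ^ (2 * n + 1) = proj m n B := by
  rw [cyc_pow_succ, succ_nsmul_fin, circulant_single_one, proj]

lemma cyc_pow_card_succ : cyc m n B ^ (2 * n + 1 + 1) = cyc m n B := by
  rw [cyc_pow_succ, succ_nsmul, succ_nsmul_fin, zero_add, cyc]

open Fin.NatCast in
lemma eq_add_mod_iff_sub_eq_nsmul_one (k : ℕ) (a b : Fin (2 * n + 1)) :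
    (a : ℕ) = (b + k) % (2 * n + 1) ↔ a - b = k • 1 := by
  rw [sub_eq_iff_eq_add', Fin.ext_iff, Fin.val_add, nsmul_one, Fin.val_natCast, Nat.add_mod_mod]

lemma cyc_pow_inr_inr (k : ℕ) (a b : Fin (2 * n + 1)) :
    (cyc m n B ^ k) (.inr a) (.inr b) = if (a : ℕ) = (b + k) % (2 * n + 1) then 1 else 0 := by
  cases k with
  | zero => simp [Matrix.one_apply, Nat.mod_eq_of_lt b.2, Fin.ext_iff]
  | succ k =>
    rw [cyc_pow_succ, fromBlocks_apply₂₂, circulant_apply, Pi.single_apply]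
    simp only [eq_add_mod_iff_sub_eq_nsmul_one]

lemma map_cyc {B' : Type} [CommRing B'] (φ : B →+* B') :
    φ.mapMatrix (cyc m n B) = cyc m n B' := by
  ext a b
  rcases a with a | a <;> rcases b with b | b <;>
    simp [cyc, Pi.single_apply, apply_ite φ]

end Cyclic

section Potential

variable {m n : ℕ} {B : Type} [CommRing B]

/-- The matrix `μ_i` over any ring. -/
def genMu (B : Type) [CommRing B] (i : Fin m) : Mat m n B :=
  single (Sum.inl (Sum.inl i)) (Sum.inr (Fin.last _)) 1 +
    single (Sum.inr 0) (Sum.inl (Sum.inr i.rev)) ((-1) ^ (n + 1))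

/-- The matrix `ν_i` over any ring. -/
def genNu (B : Type) [CommRing B] (i : Fin m) : Mat m n B :=
  single (Sum.inl (Sum.inr i)) (Sum.inr (Fin.last _)) ((-1) ^ n) -
    single (Sum.inr 0) (Sum.inl (Sum.inl i.rev)) 1

/-- The matrix `ω_i` over any ring. -/
def genOmega (B : Type) [CommRing B] (k : Fin n) : Mat m n B :=
  -single (Sum.inr ⟨n - 1 - k, by omega⟩) (Sum.inr ⟨n + k, by omega⟩) 1 -
    single (Sum.inr ⟨n - k, by omega⟩) (Sum.inr ⟨n + k + 1, by omega⟩) 1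

/-- The general element of `V_{m,n}` over any ring. -/
def potential (q r : Fin m → B) (u : Fin n → B) : Mat m n B :=
  ∑ i, q i • genMu B i + ∑ i, r (Fin.rev i) • genNu B i + ∑ k, u k • genOmega B k

lemma toMat_eq_potential (v : Fields m n) : v.toMat = potential v.q v.r v.u := rfl

lemma map_potential {B' : Type} [CommRing B'] (φ : B →+* B') (q r : Fin m → B) (u : Fin n → B) :
    φ.mapMatrix (potential q r u) = potential (φ ∘ q) (φ ∘ r) (φ ∘ u) := by
  have hsmul (c : B) (A : Mat m n B) : φ.mapMatrix (c • A) = φ c • φ.mapMatrix A :=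
    Matrix.map_smul' φ c A φ.map_mul
  simp only [potential, map_add, map_sum, hsmul, genMu, genNu, genOmega, map_sub, map_neg,
    RingHom.mapMatrix_apply, Matrix.map_single, map_one, map_pow, Function.comp]

/-- The principal grading: the position of an index, with the first block in the middle. -/
def pos : Idx m n → ℕ
  | .inl _ => n
  | .inr a => a

lemma pos_le : ∀ a : Idx m n, pos a ≤ 2 * n
  | .inl _ => by simp only [pos]; omega
  | .inr a => by simp only [pos]; omega

lemma blockTriangular_potential (q r : Fin m → B) (u : Fin n → B) :
    (potential q r u).BlockTriangular pos := by
  suffices potential q r u ∈ blockTriangularSubalgebra B B pos from this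
  refine add_mem (add_mem ?_ ?_) ?_ <;>
    refine sum_mem fun i _ => Subalgebra.smul_mem _ ?_ _
  · exact (blockTriangular_single (by simp only [pos, Fin.val_last]; omega) _).add
      (blockTriangular_single (by simp [pos]) _)
  · exact (blockTriangular_single (by simp only [pos, Fin.val_last]; omega) _).sub
      (blockTriangular_single (by simp [pos]) _)
  · exact (blockTriangular_single (by simp only [pos]; omega) _).neg.sub
      (blockTriangular_single (by simp only [pos]; omega) _)

open PowerSeries

/-- The matrix with entries `X^(pos b + 1 - pos a) A_{ab}`: the gauge transformed potential, with
the power of `X` recording the principal degree. The truncated subtraction is harmless for matrices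
that are block triangular with respect to `pos`. -/
def scaled (m n : ℕ) (B : Type) [CommRing B] : Mat m n B →+ Mat m n B⟦X⟧ where
  toFun A := Matrix.of fun a b => X ^ (pos b + 1 - pos a) * C (A a b)
  map_zero' := by ext1 a b; simp
  map_add' A A' := by ext1 a b; simp [mul_add]

lemma scaled_apply (A : Mat m n B) (a b : Idx m n) :
    scaled m n B A a b = X ^ (pos b + 1 - pos a) * C (A a b) := rfl

lemma scaled_single (i j : Idx m n) (c : B) :
    scaled m n B (single i j c) = single i j (X ^ (pos j + 1 - pos i) * C c) := by
  ext1 a b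
  rw [scaled_apply, Matrix.single_apply, Matrix.single_apply]
  split_ifs with h
  · rw [h.1, h.2]
  · rw [map_zero, mul_zero]

lemma map_scaled {B' : Type} [CommRing B'] (φ : B →+* B') (A : Mat m n B) :
    (PowerSeries.map φ).mapMatrix (scaled m n B A) = scaled m n B' (φ.mapMatrix A) := by
  ext1 a b
  simp only [RingHom.mapMatrix_apply, Matrix.map_apply, scaled_apply, map_mul, map_pow, map_X,
    map_C]

lemma entriesDvd_scaled {A : Mat m n B} (hA : A.BlockTriangular pos) :
    EntriesDvd X (scaled m n B A) := fun a b => by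
  rw [scaled_apply]
  by_cases hab : pos b < pos a
  · rw [hA hab, map_zero, mul_zero]
    exact dvd_zero X
  · exact (dvd_pow_self X (by omega)).mul_right _

end Potential

/-! ### Weights of differential polynomials -/

section HomogeneousDerivation

open MvPolynomial

variable {L K : Type*} [CommRing K]

lemma isWeightedHomogeneous_mkDerivation {M : Type*} [AddCommMonoid M] {wt : L → M} {d : M}
    {f : L → MvPolynomial L K} (hf : ∀ l, IsWeightedHomogeneous wt (f l) (wt l + d))
    {P : MvPolynomial L K} {w : M} (hP : IsWeightedHomogeneous wt P w) :
    IsWeightedHomogeneous wt (mkDerivation K f P) (w + d) := by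
  rw [P.as_sum, map_sum]
  refine IsWeightedHomogeneous.sum _ _ _ fun s hs => ?_
  rw [mkDerivation_monomial, smul_eq_C_mul]
  refine (IsWeightedHomogeneous.sum _ _ _ fun l hl => ?_).C_mul _
  rw [← hP (mem_support_iff.1 hs),
    ← Finsupp.weight_sub_single_add (Finsupp.mem_support_iff.1 hl), add_assoc]
  exact (isWeightedHomogeneous_monomial _ _ _ rfl).mul (hf l)

end HomogeneousDerivation

section GradedMatrices

open MvPolynomial

variable {I L K : Type*} [Fintype I] [DecidableEq I] [CommRing K] [Algebra ℚ K]

/-- The matrices of power series in `X` whose entry `(a, b)` has in degree `w` a coefficient of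
weight `w` and of parity `p a + p b`, so that products respect both gradings. -/
def gradedMatrices (p : I → ZMod 2) (wt : L → ℕ × ZMod 2) :
    Subalgebra ℚ (Matrix I I (PowerSeries (MvPolynomial L K))) where
  carrier := {A | ∀ a b w,
    IsWeightedHomogeneous wt (PowerSeries.coeff w (A a b)) (w, p a + p b)}
  add_mem' hA hB a b w := by simpa using (hA a b w).add (hB a b w)
  mul_mem' {A B} hA hB a b w := by
    rw [Matrix.mul_apply, map_sum]
    refine IsWeightedHomogeneous.sum _ _ _ fun c _ => ?_
    rw [PowerSeries.coeff_mul]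
    refine IsWeightedHomogeneous.sum _ _ _ fun ij hij => ?_
    have hweight : ((w, p a + p b) : ℕ × ZMod 2) = (ij.1, p a + p c) + (ij.2, p c + p b) := by
      rw [Prod.mk_add_mk, Finset.HasAntidiagonal.mem_antidiagonal.1 hij, add_assoc,
        ← add_assoc (p c), CharTwo.add_self_eq_zero, zero_add]
    rw [hweight]
    exact (hA a c ij.1).mul (hB c b ij.2)
  algebraMap_mem' r a b w := by
    rw [Matrix.algebraMap_matrix_apply]
    split_ifs with hab
    · rw [hab, CharTwo.add_self_eq_zero, IsScalarTower.algebraMap_apply ℚ (MvPolynomial L K),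
        PowerSeries.algebraMap_apply, Algebra.algebraMap_self, RingHom.id_apply,
        PowerSeries.coeff_C]
      split_ifs with hw
      · rw [hw, IsScalarTower.algebraMap_apply ℚ K]
        exact isWeightedHomogeneous_C _ _
      · exact isWeightedHomogeneous_zero _ _ _
    · exact isWeightedHomogeneous_zero _ _ _

variable {p : I → ZMod 2} {wt : L → ℕ × ZMod 2}
  {A U Λ : Matrix I I (PowerSeries (MvPolynomial L K))}

lemma X_smul_coeffwise_mem_gradedMatrices {D : MvPolynomial L K → MvPolynomial L K}
    (hD : ∀ P w, IsWeightedHomogeneous wt P w → IsWeightedHomogeneous wt (D P) (w + (1, 0)))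
    (hA : A ∈ gradedMatrices p wt) :
    (PowerSeries.X : PowerSeries (MvPolynomial L K)) • A.map (coeffwise D) ∈
      gradedMatrices p wt := fun a b w => by
  rw [Matrix.smul_apply, smul_eq_mul, Matrix.map_apply]
  cases w with
  | zero => simpa using isWeightedHomogeneous_zero _ _ _
  | succ w =>
    rw [PowerSeries.coeff_succ_X_mul, coeff_coeffwise]
    simpa using hD _ _ (hA a b w)

lemma step_mem_gradedMatrices {D : MvPolynomial L K → MvPolynomial L K}
    (hD : ∀ P w, IsWeightedHomogeneous wt P w → IsWeightedHomogeneous wt (D P) (w + (1, 0)))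
    (k : ℕ) (hΛ : Λ ∈ gradedMatrices p wt) (hU : U ∈ gradedMatrices p wt)
    (hA : A ∈ gradedMatrices p wt) : step k D Λ U A ∈ gradedMatrices p wt := by
  have hκ := neg_mem (add_mem (X_smul_coeffwise_mem_gradedMatrices hD hA)
    (sub_mem (mul_mem hU hA) (mul_mem hA hU)))
  refine add_mem hΛ (mul_mem (sub_mem (add_mem (Subalgebra.smul_mem _ (pow_mem hΛ k) _)
    (pow_mem hΛ k)) (one_mem _)) (sub_mem (sum_mem fun i _ => mul_mem (pow_mem hΛ i)
      (sum_mem fun j _ => mul_mem (mul_mem (pow_mem hΛ j) hκ) (pow_mem hΛ _)))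
    (sum_mem fun i _ => mul_mem (mul_mem (sub_mem (pow_mem hA i) (pow_mem hΛ i))
      (sub_mem hA hΛ)) (pow_mem hΛ _))))

end GradedMatrices

section TauPoly

open MvPolynomial

variable {m n : ℕ}

/-- The letter for the `x`-derivative of a letter. -/
def Letter.succ : Letter m n → Letter m n
  | .q i k => .q i (k + 1)
  | .r i k => .r i (k + 1)
  | .u i k => .u i (k + 1)

/-- The weight of a letter, that is the principal degree in which it occurs in `scaled`, together
with its parity in `q` and `r`. -/
def Letter.wt : Letter m n → ℕ × ZMod 2
  | .q _ k => (n + 1 + k, 1)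
  | .r _ k => (n + 1 + k, 1)
  | .u i k => (2 * i + 2 + k, 0)

lemma Letter.wt_succ (l : Letter m n) : l.succ.wt = l.wt + (1, 0) := by
  cases l <;> simp [Letter.succ, Letter.wt, add_assoc]

/-- The derivation `∂_x` of the differential polynomials. -/
def dPoly : Derivation ℂ (MvPolynomial (Letter m n) ℂ) (MvPolynomial (Letter m n) ℂ) :=
  mkDerivation ℂ fun l => X l.succ

lemma dPoly_X (l : Letter m n) : dPoly (X l) = X l.succ := mkDerivation_X _ _ _

lemma isWeightedHomogeneous_dPoly (P : MvPolynomial (Letter m n) ℂ) (w : ℕ × ZMod 2)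
    (hP : IsWeightedHomogeneous Letter.wt P w) :
    IsWeightedHomogeneous Letter.wt (dPoly P) (w + (1, 0)) :=
  isWeightedHomogeneous_mkDerivation
    (fun l => l.wt_succ ▸ isWeightedHomogeneous_X ℂ Letter.wt l.succ) hP

/-- The parity of an index: the first block is odd and the second one even. -/
def parity : Idx m n → ZMod 2
  | .inl _ => 1
  | .inr _ => 0

lemma cyc_mem_gradedMatrices :
    cyc m n (PowerSeries (MvPolynomial (Letter m n) ℂ)) ∈ gradedMatrices parity Letter.wt := by
  intro a b w
  rcases a with a | a <;> rcases b with b | b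
  iterate 3 simpa [cyc] using isWeightedHomogeneous_zero _ _ _
  simp only [cyc, fromBlocks_apply₂₂, circulant_apply, Pi.single_apply, parity, add_zero]
  split_ifs
  · rw [PowerSeries.coeff_one]
    split_ifs with hw
    · exact hw ▸ isWeightedHomogeneous_one _ _
    · exact isWeightedHomogeneous_zero _ _ _
  · exact isWeightedHomogeneous_zero _ _ _

lemma scaled_single_mem_gradedMatrices {i j : Idx m n} {l : Letter m n}
    (hl : l.wt = (pos j + 1 - pos i, parity i + parity j)) (c : ℂ) :
    scaled m n (MvPolynomial (Letter m n) ℂ) ((X l : MvPolynomial (Letter m n) ℂ) •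
      single i j (C c)) ∈ gradedMatrices parity Letter.wt := by
  intro a b w
  rw [Matrix.smul_single, scaled_single, Matrix.single_apply]
  split_ifs with h
  · rw [← h.1, ← h.2, PowerSeries.coeff_X_pow_mul', PowerSeries.coeff_C]
    split_ifs with hle hw
    · rw [show w = pos j + 1 - pos i by omega, ← hl, smul_eq_mul, mul_comm]
      exact (isWeightedHomogeneous_X ℂ Letter.wt l).C_mul c
    · exact isWeightedHomogeneous_zero _ _ _
    · exact isWeightedHomogeneous_zero _ _ _
  · exact isWeightedHomogeneous_zero _ _ _

/-- The potential whose coordinates are the letters of order zero. -/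
def genericPotential (m n : ℕ) : Mat m n (MvPolynomial (Letter m n) ℂ) :=
  potential (fun i => X (.q i 0)) (fun i => X (.r i 0)) (fun i => X (.u i 0))

lemma map_genericPotential {B : Type} [CommRing B] (φ : MvPolynomial (Letter m n) ℂ →+* B) :
    φ.mapMatrix (genericPotential m n) = potential (fun i => φ (X (.q i 0)))
      (fun i => φ (X (.r i 0))) (fun i => φ (X (.u i 0))) := map_potential φ _ _ _

lemma scaled_genericPotential_mem_gradedMatrices :
    scaled m n _ (genericPotential m n) ∈ gradedMatrices parity Letter.wt := by
  have hone : (1 : MvPolynomial (Letter m n) ℂ) = C 1 := C_1.symm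
  have hsign (k : ℕ) : ((-1) ^ k : MvPolynomial (Letter m n) ℂ) = C ((-1) ^ k) := by simp
  rw [genericPotential, potential, map_add, map_add, map_sum, map_sum, map_sum]
  refine add_mem (add_mem (sum_mem fun i _ => ?_) (sum_mem fun i _ => ?_))
    (sum_mem fun i _ => ?_)
  · rw [genMu, smul_add, map_add, hsign, hone]
    exact add_mem
      (scaled_single_mem_gradedMatrices (by simp [pos, parity, Letter.wt]; omega) _)
      (scaled_single_mem_gradedMatrices (by simp [pos, parity, Letter.wt]) _)
  · rw [genNu, smul_sub, map_sub, hsign, hone]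
    exact sub_mem
      (scaled_single_mem_gradedMatrices (by simp [pos, parity, Letter.wt]; omega) _)
      (scaled_single_mem_gradedMatrices (by simp [pos, parity, Letter.wt]) _)
  · rw [genOmega, smul_sub, smul_neg, map_sub, map_neg, hone]
    exact sub_mem
      (neg_mem (scaled_single_mem_gradedMatrices (by simp [pos, parity, Letter.wt]; omega) _))
      (scaled_single_mem_gradedMatrices (by simp [pos, parity, Letter.wt]; omega) _)

/-- The approximate solution of `X σ' + [Λ + U, σ] = 0`, `σ^(N+1) = σ`, with the generic
potential, that is exact below degree `w + 1`. -/
def genericResolvent (m n w : ℕ) : Mat m n (PowerSeries (MvPolynomial (Letter m n) ℂ)) :=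
  (step (2 * n + 1) dPoly (cyc m n _) (scaled m n _ (genericPotential m n)))^[w] (cyc m n _)

lemma genericResolvent_mem_gradedMatrices (w : ℕ) :
    genericResolvent m n w ∈ gradedMatrices parity Letter.wt := by
  induction w with
  | zero => exact cyc_mem_gradedMatrices
  | succ w ih =>
    rw [genericResolvent, Function.iterate_succ_apply']
    exact step_mem_gradedMatrices isWeightedHomogeneous_dPoly _ cyc_mem_gradedMatrices
      scaled_genericPotential_mem_gradedMatrices ih

/-- The differential polynomial that expresses `(ln τ)_{t₁ t_{2k+1}}`. -/
def tauPoly (m n k : ℕ) : MvPolynomial (Letter m n) ℂ :=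
  PowerSeries.coeff (2 * k + 2)
    ((genericResolvent m n (2 * k + 2) ^ (2 * k + 1)) (.inr (Fin.last _)) (.inr 0))

lemma isWeightedHomogeneous_tauPoly (k : ℕ) :
    IsWeightedHomogeneous Letter.wt (tauPoly m n k) (2 * k + 2, 0) :=
  pow_mem (genericResolvent_mem_gradedMatrices _) _ (.inr (Fin.last _)) (.inr 0) (2 * k + 2)

lemma map_tauPoly {B : Type} [CommRing B] [Algebra ℚ B] {D : B → B}
    (φ : MvPolynomial (Letter m n) ℂ →+* B) (hφ : ∀ P, φ (dPoly P) = D (φ P))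
    {σ : Mat m n (PowerSeries B)} (hσ₀ : EntriesDvd PowerSeries.X (σ - cyc m n _))
    (hσ : σ ^ (2 * n + 1 + 1) = σ)
    (hD : (PowerSeries.X : PowerSeries B) • σ.map (coeffwise D) +
      ((cyc m n _ + scaled m n B (φ.mapMatrix (genericPotential m n))) * σ -
        σ * (cyc m n _ + scaled m n B (φ.mapMatrix (genericPotential m n)))) = 0) (k : ℕ) :
    φ (tauPoly m n k) =
      PowerSeries.coeff (2 * k + 2) ((σ ^ (2 * k + 1)) (.inr (Fin.last _)) (.inr 0)) := by
  have hU : EntriesDvd PowerSeries.X (scaled m n B (φ.mapMatrix (genericPotential m n))) :=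
    entriesDvd_scaled (by rw [map_genericPotential]; exact blockTriangular_potential _ _ _)
  have hfix := step_eq_self (k := 2 * n + 1) (Nat.succ_ne_zero _) (Λ := cyc m n (PowerSeries B))
    cyc_pow_card_succ hσ hD
  have happrox := hU.sub_iterate_step hσ₀ hfix (2 * k + 2)
  have hmap := map_iterate_step φ hφ (2 * n + 1) (cyc m n _)
    (scaled m n _ (genericPotential m n)) (2 * k + 2)
  rw [map_cyc, map_scaled, ← genericResolvent] at hmap
  rw [(happrox.pow_sub_pow (2 * k + 1)).coeff_eq (Nat.lt_succ_self _), ← hmap, ← map_pow,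
    RingHom.mapMatrix_apply, Matrix.map_apply, PowerSeries.coeff_map]
  rfl

end TauPoly

/-! ### The linear coefficient -/

section Averaging

variable {m n : ℕ} {R : Type} [CommRing R]

lemma cyc_mul_single (a : Fin (2 * n + 1)) (y : Idx m n) :
    cyc m n R * single (.inr a) y 1 = single (.inr (a + 1)) y 1 := by
  ext i j
  by_cases hj : y = j
  · subst hj
    rw [Matrix.mul_single_apply_same]
    rcases i with i | i <;>
      simp [cyc, Pi.single_apply, Matrix.single_apply, sub_eq_iff_eq_add', eq_comm]
  · rw [Matrix.mul_single_apply_of_ne _ _ _ _ _ (Ne.symm hj),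
      Matrix.single_apply_of_col_ne _ _ hj]

lemma single_mul_cyc (x : Idx m n) (b : Fin (2 * n + 1)) :
    single x (.inr b) 1 * cyc m n R = single x (.inr (b - 1)) 1 := by
  ext i j
  by_cases hi : x = i
  · subst hi
    rw [Matrix.single_mul_apply_same]
    rcases j with j | j
    · simp [cyc]
    · have : b - j = 1 ↔ b - 1 = j := by grind
      simp [cyc, Pi.single_apply, Matrix.single_apply, this]
  · rw [Matrix.single_mul_apply_of_ne _ _ _ _ _ (Ne.symm hi),
      Matrix.single_apply_of_row_ne hi]

lemma cyc_pow_mul_single_mul_cyc_pow (i j : ℕ) (a b : Fin (2 * n + 1)) :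
    cyc m n R ^ i * single (.inr a) (.inr b) 1 * cyc m n R ^ j =
      single (.inr (a + i • 1)) (.inr (b - j • 1)) 1 := by
  have left : cyc m n R ^ i * single (.inr a) (.inr b) 1 =
      single (.inr (a + i • 1)) (.inr b) 1 := by
    induction i with
    | zero => simp
    | succ i ih => rw [pow_succ', Matrix.mul_assoc, ih, cyc_mul_single, succ_nsmul, add_assoc]
  rw [left]
  induction j with
  | zero => simp
  | succ j ih => rw [pow_succ, ← Matrix.mul_assoc, ih, single_mul_cyc, succ_nsmul, sub_sub]

lemma sum_single_add_add (a b : Fin (2 * n + 1)) :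
    ∑ g, (single (.inr (a + g)) (.inr (b + g)) 1 : Mat m n R) =
      fromBlocks 0 0 0 (circulant (Pi.single (a - b) 1)) := by
  ext x y
  rw [Matrix.sum_apply]
  rcases x with x | x
  · exact (Finset.sum_eq_zero fun g _ => by simp).trans (by cases y <;> simp)
  rcases y with y | y
  · exact (Finset.sum_eq_zero fun g _ => by simp).trans (by simp)
  rw [Finset.sum_eq_single (x - a) (fun g _ hg => ?_) (by simp)]
  · simp only [Matrix.single_apply, fromBlocks_apply₂₂, circulant_apply, Pi.single_apply,
      add_sub_cancel, true_and, Sum.inr.injEq]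
    congr 1
    grind
  · refine Matrix.single_apply_of_row_ne (fun h => hg ?_) _ _ _
    rw [← Sum.inr_injective h, add_sub_cancel_left]

lemma sum_cyc_pow_mul_single_mul_cyc_pow {a b : Fin (2 * n + 1)} {p : ℕ} (hp : p ≠ 0)
    (hab : (a : ℕ) = (b + p) % (2 * n + 1)) :
    ∑ i ∈ Finset.range (2 * n + 1),
      cyc m n R ^ i * single (.inr a) (.inr b) 1 * cyc m n R ^ (2 * n + 1 - i) = cyc m n R ^ p := by
  have hterm (i : Fin (2 * n + 1)) :
      cyc m n R ^ (i : ℕ) * single (.inr a) (.inr b) 1 * cyc m n R ^ (2 * n + 1 - (i : ℕ)) =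
        single (.inr (a + i)) (.inr (b + i)) 1 := by
    have hi : (i : ℕ) • (1 : Fin (2 * n + 1)) = i := by
      simpa only [sub_zero] using ((eq_add_mod_iff_sub_eq_nsmul_one i i 0).1
        (by rw [Fin.val_zero, zero_add, Nat.mod_eq_of_lt i.2])).symm
    have hneg : (2 * n + 1 - (i : ℕ)) • (1 : Fin (2 * n + 1)) = -i := by
      rw [sub_nsmul _ i.2.le, succ_nsmul_fin, hi, zero_add]
    rw [cyc_pow_mul_single_mul_cyc_pow, hi, hneg, sub_neg_eq_add]
  obtain ⟨p, rfl⟩ := Nat.exists_eq_succ_of_ne_zero hp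
  rw [Finset.sum_range, Finset.sum_congr rfl fun i _ => hterm i, sum_single_add_add,
    (eq_add_mod_iff_sub_eq_nsmul_one _ _ _).1 hab, cyc_pow_succ]

lemma sum_cyc_pow_mul_genOmega_mul_cyc_pow (k : Fin n) :
    ∑ i ∈ Finset.range (2 * n + 1),
      cyc m n R ^ i * genOmega R k * cyc m n R ^ (2 * n + 1 - i) =
        -(2 • cyc m n R ^ (2 * n - 2 * (k : ℕ))) := by
  have hk := k.2
  simp only [genOmega, mul_sub, sub_mul, mul_neg, neg_mul, Finset.sum_sub_distrib,
    Finset.sum_neg_distrib]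
  rw [sum_cyc_pow_mul_single_mul_cyc_pow (p := 2 * n - 2 * k) (by omega) ?_,
    sum_cyc_pow_mul_single_mul_cyc_pow (p := 2 * n - 2 * k) (by omega) ?_, two_nsmul, neg_add']
  all_goals
    rw [Nat.mod_eq_sub_mod (by simp only; omega), Nat.mod_eq_of_lt (by simp only; omega)]
    simp only
    omega

lemma cyc_pow_mul_genOmega_mul_cyc_pow_apply_last (k : Fin n) {i : ℕ} (hi : i ≤ 2 * k) (j : ℕ)
    (b : Idx m n) :
    (cyc m n R ^ i * genOmega R k * cyc m n R ^ j : Mat m n R) (.inr (Fin.last _)) b = 0 := by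
  have hrow {a : Fin (2 * n + 1)} (ha : a + i < 2 * n) :
      (Sum.inr (a + i • 1) : Idx m n) ≠ .inr (Fin.last _) := fun h => by
    have := (eq_add_mod_iff_sub_eq_nsmul_one i (Fin.last _) a).2
      (by rw [← Sum.inr_injective h, add_sub_cancel_left])
    rw [Nat.mod_eq_of_lt (by omega), Fin.val_last] at this
    omega
  have := k.2
  rw [genOmega, mul_sub, sub_mul, mul_neg, neg_mul, cyc_pow_mul_single_mul_cyc_pow,
    cyc_pow_mul_single_mul_cyc_pow, Matrix.sub_apply, Matrix.neg_apply,
    Matrix.single_apply_of_row_ne (hrow (by simp only; omega)),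
    Matrix.single_apply_of_row_ne (hrow (by simp only; omega)), neg_zero, sub_zero]

lemma cyc_pow_card_mul_genOmega (k : Fin n) :
    cyc m n R ^ (2 * n + 1) * genOmega R k = genOmega R k := by
  have hfix (a b : Fin (2 * n + 1)) :
      cyc m n R ^ (2 * n + 1) * single (.inr a) (.inr b) 1 = single (.inr a) (.inr b) 1 := by
    simpa [succ_nsmul_fin] using
      cyc_pow_mul_single_mul_cyc_pow (m := m) (R := R) (2 * n + 1) 0 a b
  rw [genOmega, mul_sub, mul_neg, hfix, hfix]

end Averaging

section Infinitesimal

lemma sandwichSum_add {A : Type*} [Semiring A] (x y d d' : A) (k : ℕ) :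
    sandwichSum x y (d + d') k = sandwichSum x y d k + sandwichSum x y d' k := by
  simp only [sandwichSum, mul_add, add_mul, Finset.sum_add_distrib]

lemma sandwichSum_smul_pow {K A : Type*} [CommSemiring K] [Semiring A] [Algebra K A] (c : K) (x : A)
    (p k : ℕ) : sandwichSum x x (c • x ^ p) (k + 1) = ((k + 1) * c) • x ^ (k + p) := by
  have hterm : ∀ i ∈ Finset.range (k + 1),
      x ^ i * c • x ^ p * x ^ (k + 1 - 1 - i) = c • x ^ (k + p) := fun i hi => by
    rw [mul_smul_comm, smul_mul_assoc, ← pow_add, ← pow_add]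
    congr 2
    have := Finset.mem_range.1 hi
    omega
  rw [sandwichSum, Finset.sum_congr rfl hterm, Finset.sum_const, Finset.card_range,
    ← Nat.cast_smul_eq_nsmul K, smul_smul, Nat.cast_succ]

lemma add_smul_pow_of_mul_self_eq_zero {R A : Type*} [CommRing R] [Ring A] [Algebra R A] {e : R}
    (he : e * e = 0) (x s : A) (k : ℕ) :
    (x + e • s) ^ k = x ^ k + e • sandwichSum x x s k := by
  induction k with
  | zero => simp [sandwichSum]
  | succ k ih =>
    rw [pow_succ, ih, sandwichSum_succ, pow_succ, mul_add, add_mul, add_mul, smul_mul_smul_comm, he,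
      zero_smul, add_zero, smul_add, smul_mul_assoc, mul_smul_comm, add_assoc]

lemma commute_add_smul_of_mul_self_eq_zero {R A : Type*} [CommRing R] [Ring A] [Algebra R A]
    {e : R} (he : e * e = 0) {x s w : A} (h : x * s - s * x = x * w - w * x) :
    Commute (x + e • w) (x + e • s) := by
  have hmul (a b : A) : (x + e • a) * (x + e • b) = x * x + e • (x * b + a * x) := by
    rw [mul_add, add_mul, add_mul, smul_mul_smul_comm, he, zero_smul, add_zero, mul_smul_comm,
      smul_mul_assoc, add_assoc, ← smul_add, add_comm (a * x)]
  rw [Commute, SemiconjBy, hmul, hmul, sub_eq_sub_iff_add_eq_add.1 h]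

variable {m n : ℕ} {R : Type} [CommRing R] {K : Type*} [Field K] [Algebra K R]

variable (K R) in
/-- The derivative of `σ` at the zero potential in the direction of `ω_k`, up to a power of `X`:
`ω_k` minus its average under conjugation by the powers of `Λ`. -/
def resolventDeriv (k : Fin n) : Mat m n R :=
  genOmega R k + (2 / (2 * n + 1) : K) • cyc m n R ^ (2 * n - 2 * (k : ℕ))

lemma commutator_cyc_resolventDeriv (k : Fin n) :
    cyc m n R * resolventDeriv R K k - resolventDeriv R K k * cyc m n R =
      cyc m n R * genOmega R k - genOmega R k * cyc m n R := by
  rw [resolventDeriv, mul_add, add_mul, mul_smul_comm, smul_mul_assoc, ← pow_succ, ← pow_succ',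
    add_sub_add_right_eq_sub]

lemma sandwichSum_cyc_resolventDeriv_apply (k : Fin n) :
    sandwichSum (cyc m n R) (cyc m n R) (resolventDeriv R K k) (2 * k + 1)
      (.inr (Fin.last _)) (.inr 0) = algebraMap K R (2 * (2 * k + 1) / (2 * n + 1)) := by
  have hk := k.2
  rw [resolventDeriv, sandwichSum_add, sandwichSum_smul_pow, Matrix.add_apply, sandwichSum,
    Matrix.sum_apply, Finset.sum_eq_zero fun i hi =>
      cyc_pow_mul_genOmega_mul_cyc_pow_apply_last k (Nat.lt_succ_iff.1 (Finset.mem_range.1 hi)) _ _,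
    zero_add, show 2 * (k : ℕ) + (2 * n - 2 * k) = 2 * n by omega, Matrix.smul_apply,
    cyc_pow_inr_inr, Fin.val_last, Fin.val_zero, zero_add, Nat.mod_eq_of_lt (Nat.lt_succ_self _),
    if_pos rfl, Algebra.algebraMap_eq_smul_one]
  congr 1
  push_cast
  ring

variable [CharZero K]

lemma sandwichSum_cyc_resolventDeriv (k : Fin n) :
    sandwichSum (cyc m n R) (cyc m n R) (resolventDeriv R K k) (2 * n + 1 + 1) =
      resolventDeriv R K k := by
  have hn : (2 * n + 1 : K) ≠ 0 := by exact_mod_cast (2 * n).succ_ne_zero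
  have hmul : sandwichSum (cyc m n R) (cyc m n R) (genOmega R k) (2 * n + 1) * cyc m n R =
      -(2 • cyc m n R ^ (2 * n - 2 * (k : ℕ))) := by
    rw [← sum_cyc_pow_mul_genOmega_mul_cyc_pow, sandwichSum, Finset.sum_mul]
    refine Finset.sum_congr rfl fun i hi => ?_
    rw [mul_assoc, ← pow_succ, show 2 * n + 1 - 1 - i + 1 = 2 * n + 1 - i by
      have := Finset.mem_range.1 hi; omega]
  obtain ⟨p, hp⟩ : ∃ p, 2 * n - 2 * (k : ℕ) = p + 1 := ⟨2 * n - 2 * k - 1, by omega⟩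
  have hpow : cyc m n R ^ (2 * n + 1 + (p + 1)) = cyc m n R ^ (p + 1) := by
    rw [show 2 * n + 1 + (p + 1) = 2 * n + 1 + 1 + p by ring, pow_add, cyc_pow_card_succ,
      ← pow_succ']
  rw [resolventDeriv, sandwichSum_add, sandwichSum_succ, hmul, cyc_pow_card_mul_genOmega,
    sandwichSum_smul_pow, hp, hpow, neg_add_eq_sub, sub_add_eq_add_sub, add_sub_assoc,
    ← Nat.cast_smul_eq_nsmul K, ← sub_smul]
  congr 2
  push_cast
  field_simp
  ring

end Infinitesimal

section LinearCoefficient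

open MvPolynomial

open Classical in
/-- The evaluation at the point of the dual numbers where the variable `l` has the value `ε` and
the other variables vanish; it reads off the coefficient of `l`. -/
def dualPoint {L K : Type*} [CommRing K] (l : L) : MvPolynomial L K →ₐ[K] DualNumber K :=
  aeval (Pi.single l DualNumber.eps)

variable {L K : Type*} [CommRing K]

lemma dualPoint_X_self (l : L) : dualPoint l (X l : MvPolynomial L K) = DualNumber.eps := by
  classical rw [dualPoint, aeval_X, Pi.single_eq_same]

lemma dualPoint_X_of_ne {l l' : L} (h : l' ≠ l) : dualPoint l (X l' : MvPolynomial L K) = 0 := by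
  classical rw [dualPoint, aeval_X, Pi.single_eq_of_ne h]

lemma dualPoint_eq (l : L) (P : MvPolynomial L K) :
    dualPoint l P = TrivSqZeroExt.inl (coeff 0 P) +
      TrivSqZeroExt.inr (coeff (Finsupp.single l 1) P) := by
  classical
  induction P using MvPolynomial.induction_on with
  | C a =>
    rw [dualPoint, aeval_C, coeff_C, coeff_C, if_pos rfl,
      if_neg (Finsupp.single_ne_zero.2 one_ne_zero).symm, TrivSqZeroExt.inr_zero, add_zero]
    rfl
  | add P Q hP hQ =>
    rw [map_add, hP, hQ, coeff_add, coeff_add, TrivSqZeroExt.inl_add, TrivSqZeroExt.inr_add,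
      add_add_add_comm]
  | mul_X P l' hP =>
    rw [map_mul, hP, coeff_mul_X', coeff_mul_X', if_neg (by simp)]
    by_cases h : l' = l
    · rw [h, dualPoint_X_self, if_pos (by simp)]
      ext <;> simp
    · rw [dualPoint_X_of_ne h, if_neg (by simpa using h)]
      simp

variable {m n : ℕ}

lemma dualPoint_dPoly (j : Fin n) (P : MvPolynomial (Letter m n) ℂ) :
    dualPoint (.u j 0) (dPoly P) = 0 := by
  induction P using MvPolynomial.induction_on with
  | C a => rw [← algebraMap_eq, Derivation.map_algebraMap, map_zero]
  | add P Q hP hQ => rw [map_add, map_add, hP, hQ, add_zero]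
  | mul_X P l hP =>
    have hl : l.succ ≠ .u j 0 := by cases l <;> simp [Letter.succ]
    rw [Derivation.leibniz, dPoly_X, smul_eq_mul, smul_eq_mul, map_add, map_mul, map_mul,
      dualPoint_X_of_ne hl, hP, mul_zero, mul_zero, add_zero]

lemma scaled_smul_genOmega {B : Type} [CommRing B] (c : B) (j : Fin n) :
    scaled m n B (c • genOmega B j) =
      (PowerSeries.X ^ (2 * (j : ℕ) + 2) * PowerSeries.C c) • genOmega (PowerSeries B) j := by
  have hj := j.2
  have h₁ : n + (j : ℕ) + 1 - (n - 1 - j) = 2 * j + 2 := by omega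
  have h₂ : n + (j : ℕ) + 1 + 1 - (n - j) = 2 * j + 2 := by omega
  simp only [genOmega, smul_sub, smul_neg, Matrix.smul_single, smul_eq_mul, mul_one, map_sub,
    map_neg, scaled_single, pos, h₁, h₂]

lemma map_dualPoint_genericPotential (j : Fin n) :
    (dualPoint (.u j 0)).toRingHom.mapMatrix (genericPotential m n) =
      (DualNumber.eps : DualNumber ℂ) • genOmega (DualNumber ℂ) j := by
  have hq (i : Fin m) : dualPoint (.u j 0) (X (.q i 0) : MvPolynomial (Letter m n) ℂ) = 0 :=
    dualPoint_X_of_ne (by simp)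
  have hr (i : Fin m) : dualPoint (.u j 0) (X (.r i 0) : MvPolynomial (Letter m n) ℂ) = 0 :=
    dualPoint_X_of_ne (by simp)
  rw [map_genericPotential, potential]
  simp only [AlgHom.toRingHom_eq_coe, RingHom.coe_coe, hq, hr, zero_smul, Finset.sum_const_zero,
    zero_add]
  rw [Finset.sum_eq_single j (fun i _ hi => ?_) (by simp), dualPoint_X_self]
  rw [dualPoint_X_of_ne (by simpa using hi), zero_smul]

lemma coeff_tauPoly (j : Fin n) :
    coeff (Finsupp.single (.u j 0) 1) (tauPoly m n j) = 2 * (2 * (j : ℂ) + 1) / (2 * n + 1) := by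
  set e : PowerSeries (DualNumber ℂ) :=
    PowerSeries.X ^ (2 * (j : ℕ) + 2) * PowerSeries.C DualNumber.eps with he
  have hee : e * e = 0 := by
    rw [he, mul_mul_mul_comm, ← map_mul, DualNumber.eps_mul_eps, map_zero, mul_zero]
  let Λ := cyc m n (PowerSeries (DualNumber ℂ))
  let s : Mat m n (PowerSeries (DualNumber ℂ)) := resolventDeriv _ ℂ j
  have hdvd : EntriesDvd PowerSeries.X (Λ + e • s - Λ) := by
    rw [add_sub_cancel_left, he, pow_succ', mul_assoc, mul_smul]
    exact .smul _
  have hpow : (Λ + e • s) ^ (2 * n + 1 + 1) = Λ + e • s := by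
    rw [add_smul_pow_of_mul_self_eq_zero hee, cyc_pow_card_succ, sandwichSum_cyc_resolventDeriv]
  have hcomm : Commute (Λ + e • genOmega _ j) (Λ + e • s) :=
    commute_add_smul_of_mul_self_eq_zero hee (commutator_cyc_resolventDeriv j)
  have hzero : (Λ + e • s).map (coeffwise fun _ => (0 : DualNumber ℂ)) = 0 := by
    ext1 a b; ext1 i; simp only [Matrix.map_apply, coeff_coeffwise, Matrix.zero_apply, map_zero]
  let φ : MvPolynomial (Letter m n) ℂ →ₐ[ℂ] DualNumber ℂ := dualPoint (.u j 0)
  have hD := map_tauPoly (D := fun _ => 0) (σ := Λ + e • s) φ.toRingHom (dualPoint_dPoly j) hdvd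
    hpow
  have hval : φ (tauPoly m n j) = _ := hD (by
    rw [map_dualPoint_genericPotential, scaled_smul_genOmega, hzero, smul_zero, zero_add, hcomm.eq,
      sub_self]) j
  have hentry : ((Λ + e • s) ^ (2 * (j : ℕ) + 1)) (.inr (Fin.last _)) (.inr 0) =
      e * algebraMap ℂ _ (2 * (2 * (j : ℂ) + 1) / (2 * n + 1)) := by
    rw [add_smul_pow_of_mul_self_eq_zero hee, Matrix.add_apply, cyc_pow_inr_inr, if_neg, zero_add,
      Matrix.smul_apply, sandwichSum_cyc_resolventDeriv_apply, smul_eq_mul]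
    rw [Fin.val_last, Fin.val_zero, zero_add, Nat.mod_eq_of_lt (by omega)]
    omega
  rw [hentry, he, mul_right_comm, mul_assoc, PowerSeries.coeff_X_pow_mul', if_pos le_rfl] at hval
  rw [dualPoint_eq] at hval
  have hsnd := congrArg TrivSqZeroExt.snd hval
  simpa [PowerSeries.algebraMap_apply, TrivSqZeroExt.algebraMap_eq_inl] using hsnd

end LinearCoefficient

section Variables

open MvPolynomial

variable {m n : ℕ}

lemma wt_fst_le_weight {s : Letter m n →₀ ℕ} {l : Letter m n} (hl : l ∈ s.support) :
    l.wt.1 ≤ (Finsupp.weight Letter.wt s).1 := by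
  rw [← Finsupp.weight_sub_single_add (Finsupp.mem_support_iff.1 hl)]
  exact Nat.le_add_left _ _

lemma succ_le_weight_of_odd {s : Letter m n →₀ ℕ} (hs : (Finsupp.weight Letter.wt s).2 = 1) :
    n + 1 ≤ (Finsupp.weight Letter.wt s).1 := by
  obtain ⟨l, hl, hodd⟩ : ∃ l ∈ s.support, l.wt.2 ≠ 0 := by
    by_contra! heven
    rw [Finsupp.weight_apply, Finsupp.sum, Prod.snd_sum, Finset.sum_eq_zero fun l hl => by
      rw [Prod.smul_snd, heven l hl, smul_zero]] at hs
    exact zero_ne_one hs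
  refine le_trans ?_ (wt_fst_le_weight hl)
  cases l <;> simp_all [Letter.wt]

lemma le_of_odd_mem_support {P : MvPolynomial (Letter m n) ℂ} {w k : ℕ}
    (hP : IsWeightedHomogeneous Letter.wt P (w, 0)) {s : Letter m n →₀ ℕ} (hs : s ∈ P.support)
    {l : Letter m n} (hl : l ∈ s.support) (hwt : l.wt = (n + 1 + k, 1)) :
    2 * n + 2 + k ≤ w := by
  have hweight := Finsupp.weight_sub_single_add (w := Letter.wt) (Finsupp.mem_support_iff.1 hl)
  rw [hP (mem_support_iff.1 hs), hwt, Prod.ext_iff] at hweight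
  obtain ⟨hfst, hsnd⟩ := hweight
  have hodd : (Finsupp.weight Letter.wt (s - Finsupp.single l 1)).2 = 1 :=
    (eq_neg_of_add_eq_zero_left hsnd).trans (show (-1 : ZMod 2) = 1 by decide)
  have := succ_le_weight_of_odd hodd
  simp only [Prod.fst_add] at hfst
  omega

lemma qrOrderLE_of_isWeightedHomogeneous {P : MvPolynomial (Letter m n) ℂ} {d : ℕ}
    (hP : IsWeightedHomogeneous Letter.wt P (2 * n + 2 + d, 0)) : QROrderLE d P := by
  intro l hl i k hk
  obtain ⟨s, hs, hls⟩ := (mem_vars_iff_mem_support l).1 hl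
  have := le_of_odd_mem_support hP hs hls (k := k) (by rcases hk with rfl | rfl <;> rfl)
  omega

lemma eq_single_of_weight_eq {s : Letter m n →₀ ℕ} {l : Letter m n} (hl : l ∈ s.support)
    (hs : Finsupp.weight Letter.wt s = l.wt) : s = Finsupp.single l 1 := by
  have hl' := Finsupp.mem_support_iff.1 hl
  have hrest : Finsupp.weight Letter.wt (s - Finsupp.single l 1) = 0 := by
    rw [← add_eq_right, Finsupp.weight_sub_single_add hl', hs]
  rw [← Finsupp.sub_add_single_one_cancel hl', add_eq_right]
  by_contra hne
  obtain ⟨l', hl'⟩ := Finsupp.support_nonempty_iff.2 hne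
  have hle := wt_fst_le_weight hl'
  have hpos : 0 < l'.wt.1 := by cases l' <;> simp [Letter.wt]
  rw [hrest] at hle
  exact absurd hle hpos.not_ge

lemma involvesOnlyULt_sub_C_mul_X {P : MvPolynomial (Letter m n) ℂ} {j : Fin n}
    (hP : IsWeightedHomogeneous Letter.wt P (2 * j + 2, 0)) :
    InvolvesOnlyULt j (P - C (coeff (Finsupp.single (.u j 0) 1) P) * X (.u j 0)) := by
  classical
  have hj := j.2
  have hQ := hP.sub ((isWeightedHomogeneous_X ℂ Letter.wt (.u j 0)).C_mul
    (coeff (Finsupp.single (.u j 0) 1) P))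
  intro l hl
  obtain ⟨s, hs, hls⟩ := (mem_vars_iff_mem_support l).1 hl
  cases l with
  | q i k => have := le_of_odd_mem_support hQ hs hls (k := k) rfl; omega
  | r i k => have := le_of_odd_mem_support hQ hs hls (k := k) rfl; omega
  | u i k =>
    have hweight := hQ (mem_support_iff.1 hs)
    have hle : 2 * (i : ℕ) + 2 + k ≤ 2 * j + 2 := by
      simpa only [hweight, Letter.wt] using wt_fst_le_weight hls
    refine ⟨i, k, ?_, rfl⟩
    by_contra hlt
    obtain rfl : i = j := Fin.ext (by omega)
    obtain rfl : k = 0 := by omega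
    rw [eq_single_of_weight_eq hls hweight, mem_support_iff, coeff_sub, coeff_C_mul, coeff_X,
      if_pos rfl, mul_one, sub_self] at hs
    exact hs rfl

end Variables

/-! ### Calculus of formal loops -/

section Calculus

open MvPowerSeries
open scoped Pointwise

/-- The exponents of `λ⁻¹` in `a` lie in `s`. -/
def SuppIn (s : Set ℤ) (a : LFun) : Prop := ∀ α e, e ∉ s → (coeff α a).coeff e = 0

namespace SuppIn

variable {s t : Set ℤ} {a b : LFun}

lemma mono (h : SuppIn s a) (hs : s ⊆ t) : SuppIn t a := fun α e he => h α e fun h' => he (hs h')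

lemma zero : SuppIn s 0 := fun _ _ _ => by simp

lemma add (h : SuppIn s a) (h' : SuppIn s b) : SuppIn s (a + b) := fun α e he => by
  simp [h α e he, h' α e he]

lemma sum {ι : Type*} {S : Finset ι} {F : ι → LFun} (h : ∀ i ∈ S, SuppIn s (F i)) :
    SuppIn s (∑ i ∈ S, F i) := fun α e he => by
  rw [map_sum, HahnSeries.coeff_sum]
  exact Finset.sum_eq_zero fun i hi => h i hi α e he

lemma mul (h : SuppIn s a) (h' : SuppIn t b) : SuppIn (s + t) (a * b) := fun α e he => by
  classical
  rw [coeff_mul, HahnSeries.coeff_sum]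
  refine Finset.sum_eq_zero fun βγ _ => ?_
  rw [HahnSeries.coeff_mul]
  refine Finset.sum_eq_zero fun ij hij => ?_
  rw [Finset.mem_antidiagonal] at hij
  by_cases hi : ij.1 ∈ s
  · rw [h' _ _ fun hj => he (hij.2.2 ▸ Set.add_mem_add hi hj), mul_zero]
  · rw [h _ _ hi, zero_mul]

lemma flip (h : SuppIn s a) : SuppIn s (flip a) := fun α e he => by
  change ((e.negOnePow : ℤ) : ℂ) * (coeff α a).coeff e = 0
  rw [h α e he, mul_zero]

end SuppIn

lemma suppIn_ofFun (a : Fun) : SuppIn 0 (ofFun a) := fun α e he => by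
  rw [ofFun, coeff_map, HahnSeries.C_apply, HahnSeries.coeff_single_of_ne (by simpa using he)]

lemma suppIn_one : SuppIn 0 1 := map_one ofFun ▸ suppIn_ofFun 1

/-- The loop `λ^(-e)`. -/
def lamPow (e : ℤ) : LFun := ofLoop (HahnSeries.single e 1)

lemma lamPow_mul (e e' : ℤ) : lamPow e * lamPow e' = lamPow (e + e') := by
  rw [lamPow, lamPow, ← map_mul, HahnSeries.single_mul_single, mul_one]; rfl

lemma lamPow_zero : lamPow 0 = 1 := map_one ofLoop

lemma lamPow_pow (e : ℤ) (k : ℕ) : lamPow e ^ k = lamPow (k * e) := by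
  rw [lamPow, ← map_pow, HahnSeries.single_pow, one_pow, nsmul_eq_mul]; rfl

lemma coeff_lamPow_mul (e : ℤ) (a : LFun) (α : ℕ →₀ ℕ) (i : ℤ) :
    (coeff α (lamPow e * a)).coeff i = (coeff α a).coeff (i - e) := by
  rw [lamPow, ofLoop, coeff_C_mul, HahnSeries.coeff_single_mul, one_mul]

lemma suppIn_lamPow (e : ℤ) : SuppIn {e} (lamPow e) := fun α i hi => by
  rw [← mul_one (lamPow e), coeff_lamPow_mul]
  exact suppIn_one α _ (by simpa [sub_eq_zero] using hi)

lemma dtL_add (k : ℕ) (a b : LFun) : dtL k (a + b) = dtL k a + dtL k b := map_add _ _ _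

lemma dtL_sub (k : ℕ) (a b : LFun) : dtL k (a - b) = dtL k a - dtL k b := map_sub _ _ _

lemma dtL_mul (k : ℕ) (a b : LFun) : dtL k (a * b) = dtL k a * b + a * dtL k b := by
  rw [dtL, Derivation.leibniz, smul_eq_mul, smul_eq_mul, add_comm, mul_comm b]; rfl

lemma dtL_ofLoop (k : ℕ) (a : LaurentSeries ℂ) : dtL k (ofLoop a) = 0 := pderiv_C

lemma coeff_dtL (k : ℕ) (a : LFun) (α : ℕ →₀ ℕ) (e : ℤ) :
    (coeff α (dtL k a)).coeff e = (coeff (α + Finsupp.single k 1) a).coeff e * (α k + 1) := by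
  rw [dtL, coeff_pderiv, ← map_natCast HahnSeries.C, ← map_one HahnSeries.C, ← map_add,
    HahnSeries.C_apply, HahnSeries.coeff_mul_single_zero]

lemma SuppIn.dtL {s : Set ℤ} {a : LFun} (h : SuppIn s a) (k : ℕ) : SuppIn s (dtL k a) :=
  fun α e he => by rw [coeff_dtL, h _ _ he, zero_mul]

/-- The Euler operator `-λ ∂_λ`. -/
def euler (h : LaurentSeries ℂ) : LaurentSeries ℂ where
  coeff e := e * h.coeff e
  isPWO_support' := h.isPWO_support.mono fun e he hc => he (by simp [hc])

lemma coeff_euler (h : LaurentSeries ℂ) (e : ℤ) : (euler h).coeff e = e * h.coeff e := rfl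

lemma support_euler_subset (h : LaurentSeries ℂ) : (euler h).support ⊆ h.support :=
  fun e he hc => he (by simp [coeff_euler, hc])

lemma euler_mul (a b : LaurentSeries ℂ) : euler (a * b) = euler a * b + a * euler b := by
  ext e
  rw [coeff_euler, HahnSeries.coeff_add, HahnSeries.coeff_mul,
    HahnSeries.coeff_mul_left' a.isPWO_support (support_euler_subset a),
    HahnSeries.coeff_mul_right' b.isPWO_support (support_euler_subset b), Finset.mul_sum,
    ← Finset.sum_add_distrib]
  refine Finset.sum_congr rfl fun ij hij => ?_
  rw [← (Finset.mem_antidiagonal.1 hij).2.2, coeff_euler, coeff_euler]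
  push_cast
  ring

lemma coeff_dLam₀ (h : LaurentSeries ℂ) (e : ℤ) :
    (dLam₀ h).coeff e = -((e - 1 : ℤ) : ℂ) * h.coeff (e - 1) := by
  rw [dLam₀, HahnSeries.coeff_neg, HahnSeries.coeff_single_mul, one_mul,
    LaurentSeries.hasseDeriv_coeff, Ring.choose_one_right]
  simp only [Nat.cast_one, zsmul_eq_mul, neg_mul, show e - 2 + 1 = e - 1 by ring]

lemma dLam₀_eq (h : LaurentSeries ℂ) : dLam₀ h = -(HahnSeries.single 1 1 * euler h) := by
  ext e
  rw [coeff_dLam₀, HahnSeries.coeff_neg, HahnSeries.coeff_single_mul, one_mul, coeff_euler, neg_mul]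

lemma dLam₀_add (a b : LaurentSeries ℂ) : dLam₀ (a + b) = dLam₀ a + dLam₀ b := by
  ext e; simp only [coeff_dLam₀, HahnSeries.coeff_add]; ring

lemma dLam₀_mul (a b : LaurentSeries ℂ) : dLam₀ (a * b) = dLam₀ a * b + a * dLam₀ b := by
  rw [dLam₀_eq, dLam₀_eq, dLam₀_eq, euler_mul]
  ring

lemma coeff_dLam (a : LFun) (α : ℕ →₀ ℕ) (e : ℤ) :
    (coeff α (dLam a)).coeff e = -((e - 1 : ℤ) : ℂ) * (coeff α a).coeff (e - 1) :=
  coeff_dLam₀ _ _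

lemma dLam_add (a b : LFun) : dLam (a + b) = dLam a + dLam b := by
  ext1 α
  exact dLam₀_add _ _

lemma dLam_sub (a b : LFun) : dLam (a - b) = dLam a - dLam b :=
  map_sub (AddMonoidHom.mk' _ dLam_add) a b

lemma dLam_mul (a b : LFun) : dLam (a * b) = dLam a * b + a * dLam b := by
  classical
  ext1 α
  change AddMonoidHom.mk' dLam₀ dLam₀_add (coeff α (a * b)) = _
  rw [map_add, coeff_mul, coeff_mul, coeff_mul, ← Finset.sum_add_distrib, map_sum]
  exact Finset.sum_congr rfl fun _ _ => dLam₀_mul _ _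

lemma dLam_dtL (k : ℕ) (a : LFun) : dLam (dtL k a) = dtL k (dLam a) := by
  ext1 α
  ext e
  rw [coeff_dLam, coeff_dtL, coeff_dtL, coeff_dLam]
  ring

lemma dLam_eq_zero {a : LFun} (h : SuppIn 0 a) : dLam a = 0 := by
  ext1 α
  ext e
  rw [coeff_dLam]
  by_cases he : e - 1 = 0
  · simp [he]
  · rw [h _ _ he, mul_zero]; simp

lemma dLam_ofFun (a : Fun) : dLam (ofFun a) = 0 := dLam_eq_zero (suppIn_ofFun a)

lemma dLam_lamPow_neg_one : dLam (lamPow (-1)) = 1 := by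
  ext1 α
  ext e
  rw [coeff_dLam, ← mul_one (lamPow _), coeff_lamPow_mul, sub_neg_eq_add, sub_add_cancel]
  by_cases he : e = 0
  · simp [he]
  · rw [suppIn_one _ _ he, mul_zero]

lemma SuppIn.dLam {a : LFun} (h : SuppIn (Set.Ici 0) a) : SuppIn (Set.Ici 2) (dLam a) :=
  fun α e he => by
    rw [coeff_dLam]
    by_cases h1 : e - 1 = 0
    · simp [h1]
    · rw [h α (e - 1) (by simp only [Set.mem_Ici] at he ⊢; omega), mul_zero]

lemma coeff_plus (a : LFun) (α : ℕ →₀ ℕ) (e : ℤ) :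
    (coeff α (plus a)).coeff e = if e < 1 then (coeff α a).coeff e else 0 := rfl

lemma plus_sub (a b : LFun) : plus (a - b) = plus a - plus b := by
  ext1 α; ext e; rw [map_sub, HahnSeries.coeff_sub, coeff_plus, coeff_plus, coeff_plus]
  split_ifs <;> simp

lemma plus_eq_self_iff {a : LFun} : plus a = a ↔ SuppIn (Set.Iic 0) a := by
  refine ⟨fun h α e he => ?_, fun h => ?_⟩
  · rw [← h, coeff_plus, if_neg (by simpa [Int.lt_iff_add_one_le] using he)]
  · ext1 α; ext e; rw [coeff_plus]
    split_ifs with he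
    · rfl
    · exact (h α e (by simpa [Int.lt_iff_add_one_le] using he)).symm

lemma plus_eq_zero_iff {a : LFun} : plus a = 0 ↔ SuppIn (Set.Ici 1) a := by
  refine ⟨fun h α e he => ?_, fun h => ?_⟩
  · have := coeff_plus a α e
    rw [h, if_pos (by simpa using he)] at this
    simpa using this.symm
  · ext1 α; ext e; rw [coeff_plus]
    split_ifs with he
    · rw [h α e (by simpa using he)]; simp
    · simp

lemma coeff_coeffLam (i : ℤ) (a : LFun) (α : ℕ →₀ ℕ) :
    coeff α (coeffLam i a) = (coeff α a).coeff (-i) := rfl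

lemma coeffLam_add (i : ℤ) (a b : LFun) : coeffLam i (a + b) = coeffLam i a + coeffLam i b := by
  ext1 α; simp [coeff_coeffLam]

lemma coeffLam_neg (i : ℤ) (a : LFun) : coeffLam i (-a) = -coeffLam i a := by
  ext1 α; simp [coeff_coeffLam]

lemma coeffLam_eq_zero {s : Set ℤ} {a : LFun} (h : SuppIn s a) {i : ℤ} (hi : -i ∉ s) :
    coeffLam i a = 0 := by
  ext1 α; exact h α _ hi

lemma dt_coeffLam (k : ℕ) (i : ℤ) (a : LFun) : dt k (coeffLam i a) = coeffLam i (dtL k a) := by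
  ext1 α
  rw [coeff_coeffLam, coeff_dtL, dt, coeff_pderiv, coeff_coeffLam]

end Calculus

/-! ### Matrices of formal loops -/

section Leibniz

variable {I R : Type*} [Ring R] {D : R →+ R}

lemma map_one_of_leibniz [DecidableEq I] (hD : ∀ a b, D (a * b) = D a * b + a * D b) :
    (1 : Matrix I I R).map D = 0 := by
  have hone : D 1 = 0 := left_eq_add.1 (by simpa only [mul_one, one_mul] using hD 1 1)
  ext1 a b
  rw [Matrix.map_apply, Matrix.one_apply, apply_ite D, hone, map_zero, ite_self,
    Matrix.zero_apply]

variable [Fintype I]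

lemma map_mul_of_leibniz (hD : ∀ a b, D (a * b) = D a * b + a * D b) (A A' : Matrix I I R) :
    (A * A').map D = A.map D * A' + A * A'.map D := by
  ext i j
  simp only [Matrix.map_apply, Matrix.add_apply, Matrix.mul_apply, map_sum, hD,
    Finset.sum_add_distrib]

lemma map_inv_of_leibniz [DecidableEq I] (hD : ∀ a b, D (a * b) = D a * b + a * D b)
    {A A' : Matrix I I R} (h : A * A' = 1) (h' : A' * A = 1) : A'.map D = -(A' * A.map D * A') := by
  have hD' : A.map D * A' + A * A'.map D = 0 := by
    rw [← map_mul_of_leibniz hD, h, map_one_of_leibniz hD]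
  rw [← one_mul (A'.map D), ← h', mul_assoc A', eq_neg_of_add_eq_zero_right hD', mul_neg,
    mul_assoc A']

end Leibniz

section MatrixCalculus

open scoped Pointwise

variable {I : Type*}

/-- The exponents of `λ⁻¹` in the entries of `A` lie in `s`. -/
def EntriesSuppIn (s : Set ℤ) (A : Matrix I I LFun) : Prop := ∀ a b, SuppIn s (A a b)

lemma map_plus_eq_self_iff {A : Matrix I I LFun} :
    A.map plus = A ↔ EntriesSuppIn (Set.Iic 0) A := by
  simp only [← Matrix.ext_iff, Matrix.map_apply, plus_eq_self_iff, EntriesSuppIn]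

lemma map_plus_eq_zero_iff {A : Matrix I I LFun} :
    A.map plus = 0 ↔ EntriesSuppIn (Set.Ici 1) A := by
  simp only [← Matrix.ext_iff, Matrix.map_apply, Matrix.zero_apply, plus_eq_zero_iff, EntriesSuppIn]

lemma entriesSuppIn_ofFun (A : Matrix I I Fun) : EntriesSuppIn 0 (A.map ofFun) :=
  fun _ _ => suppIn_ofFun _

lemma entriesSuppIn_one [DecidableEq I] : EntriesSuppIn 0 (1 : Matrix I I LFun) := fun a b => by
  rw [Matrix.one_apply]
  split_ifs
  exacts [suppIn_one, SuppIn.zero]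

lemma map_dLam_ofFun (A : Matrix I I Fun) : (A.map ofFun).map dLam = 0 := by
  ext1 a b
  exact dLam_ofFun _

lemma map_dtL_ofLoop (k : ℕ) (A : Matrix I I (LaurentSeries ℂ)) :
    (A.map ofLoop).map (dtL k) = 0 := by
  ext1 a b
  exact dtL_ofLoop _ _

lemma map_dLam_map_dtL (k : ℕ) (A : Matrix I I LFun) :
    (A.map (dtL k)).map dLam = (A.map dLam).map (dtL k) := by
  ext1 a b
  exact dLam_dtL _ _

namespace EntriesSuppIn

variable {s t : Set ℤ} {A A' : Matrix I I LFun}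

lemma mono (h : EntriesSuppIn s A) (hs : s ⊆ t) : EntriesSuppIn t A := fun a b => (h a b).mono hs

lemma add (h : EntriesSuppIn s A) (h' : EntriesSuppIn s A') : EntriesSuppIn s (A + A') :=
  fun a b => (h a b).add (h' a b)

lemma dtL (h : EntriesSuppIn s A) (k : ℕ) : EntriesSuppIn s (A.map (dtL k)) :=
  fun a b => (h a b).dtL k

variable [Fintype I]

lemma mul (h : EntriesSuppIn s A) (h' : EntriesSuppIn t A') : EntriesSuppIn (s + t) (A * A') :=
  fun a b => SuppIn.sum fun c _ => (h a c).mul (h' c b)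

lemma mul_Ici {i j : ℤ} (h : EntriesSuppIn (Set.Ici i) A) (h' : EntriesSuppIn (Set.Ici j) A') :
    EntriesSuppIn (Set.Ici (i + j)) (A * A') :=
  (h.mul h').mono (Set.Ici_add_Ici_subset i j)

lemma mul_Iic {i j : ℤ} (h : EntriesSuppIn (Set.Iic i) A) (h' : EntriesSuppIn (Set.Iic j) A') :
    EntriesSuppIn (Set.Iic (i + j)) (A * A') :=
  (h.mul h').mono (Set.Iic_add_Iic_subset i j)

lemma trace (h : EntriesSuppIn s A) : SuppIn s A.trace := SuppIn.sum fun a _ => h a a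

end EntriesSuppIn

lemma map_dtL_one [DecidableEq I] (k : ℕ) : (1 : Matrix I I LFun).map (dtL k) = 0 :=
  map_one_of_leibniz (D := AddMonoidHom.mk' _ (dtL_add k)) (dtL_mul k)

variable [Fintype I]

lemma map_dtL_mul (k : ℕ) (A A' : Matrix I I LFun) :
    (A * A').map (dtL k) = A.map (dtL k) * A' + A * A'.map (dtL k) :=
  map_mul_of_leibniz (D := AddMonoidHom.mk' _ (dtL_add k)) (dtL_mul k) A A'

lemma map_dLam_mul (A A' : Matrix I I LFun) :
    (A * A').map dLam = A.map dLam * A' + A * A'.map dLam :=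
  map_mul_of_leibniz (D := AddMonoidHom.mk' _ dLam_add) dLam_mul A A'

variable [DecidableEq I]

lemma map_dtL_inv (k : ℕ) {A A' : Matrix I I LFun} (h : A * A' = 1) :
    A'.map (dtL k) = -(A' * A.map (dtL k) * A') :=
  map_inv_of_leibniz (D := AddMonoidHom.mk' _ (dtL_add k)) (dtL_mul k) h (mul_eq_one_comm.1 h)

lemma map_dLam_inv {A A' : Matrix I I LFun} (h : A * A' = 1) :
    A'.map dLam = -(A' * A.map dLam * A') :=
  map_inv_of_leibniz (D := AddMonoidHom.mk' _ dLam_add) dLam_mul h (mul_eq_one_comm.1 h)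

end MatrixCalculus

/-! ### The second derivatives of the tau function -/

section Conjugation

variable {I R : Type*} [Fintype I]

lemma trace_commutator_mul [CommRing R] (A B C : Matrix I I R) :
    ((A * B - B * A) * C).trace = (A * (B * C - C * B)).trace := by
  rw [sub_mul, mul_sub, Matrix.trace_sub, Matrix.trace_sub, mul_assoc, mul_assoc B,
    Matrix.trace_mul_comm B, mul_assoc]

lemma trace_zeroCurvature_mul [CommRing R] {A Q : Matrix I I R} (h : Q * A = A * Q)
    (B K L L' : Matrix I I R) :
    ((L * Q - Q * L + K - (L' + (L * B - B * L))) * A).trace =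
      (K * A).trace - (L' * A + L * (B * A - A * B)).trace := by
  rw [sub_mul, add_mul, add_mul, Matrix.trace_sub, Matrix.trace_add, Matrix.trace_add,
    Matrix.trace_add, trace_commutator_mul, trace_commutator_mul, h, sub_self, mul_zero,
    Matrix.trace_zero, zero_add]

variable [DecidableEq I]

lemma map_conj_of_leibniz [Ring R] {D : R →+ R} (hD : ∀ a b, D (a * b) = D a * b + a * D b)
    {M N : Matrix I I R} (h : M * N = 1) (h' : N * M = 1) (A : Matrix I I R) :
    (M * A * N).map D =
      M.map D * N * (M * A * N) - M * A * N * (M.map D * N) + M * A.map D * N := by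
  have hNM (B : Matrix I I R) : N * (M * B) = B := by rw [← mul_assoc, h', one_mul]
  rw [map_mul_of_leibniz hD, map_mul_of_leibniz hD, map_inv_of_leibniz hD h h']
  simp only [mul_assoc, hNM, add_mul, mul_neg]
  abel

lemma map_logDeriv_of_leibniz [Ring R] {D d : R →+ R}
    (hD : ∀ a b, D (a * b) = D a * b + a * D b) (hd : ∀ a b, d (a * b) = d a * b + a * d b)
    {M N : Matrix I I R} (h : M * N = 1) (h' : N * M = 1)
    (hDd : (M.map d).map D = (M.map D).map d) :
    (M.map d * N).map D =
      (M.map D * N).map d + (M.map D * N * (M.map d * N) - M.map d * N * (M.map D * N)) := by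
  rw [map_mul_of_leibniz hD, map_mul_of_leibniz hd, map_inv_of_leibniz hD h h',
    map_inv_of_leibniz hd h h', hDd]
  noncomm_ring

lemma map_dtL_conj (k : ℕ) {M N A : Matrix I I LFun} (h : M * N = 1) (hA : A.map (dtL k) = 0) :
    (M * A * N).map (dtL k) =
      M.map (dtL k) * N * (M * A * N) - M * A * N * (M.map (dtL k) * N) := by
  have := map_conj_of_leibniz (D := AddMonoidHom.mk' _ (dtL_add k)) (dtL_mul k) h
    (mul_eq_one_comm.1 h) A
  rwa [show A.map (AddMonoidHom.mk' _ (dtL_add k)) = 0 from hA, mul_zero, zero_mul, add_zero]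
    at this

lemma map_dLam_conj {M N : Matrix I I LFun} (h : M * N = 1) (A : Matrix I I LFun) :
    (M * A * N).map dLam =
      M.map dLam * N * (M * A * N) - M * A * N * (M.map dLam * N) + M * A.map dLam * N :=
  map_conj_of_leibniz (D := AddMonoidHom.mk' _ dLam_add) dLam_mul h (mul_eq_one_comm.1 h) A

lemma map_dLam_logDeriv (k : ℕ) {M N : Matrix I I LFun} (h : M * N = 1) :
    (M.map (dtL k) * N).map dLam = (M.map dLam * N).map (dtL k) +
      (M.map dLam * N * (M.map (dtL k) * N) - M.map (dtL k) * N * (M.map dLam * N)) :=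
  map_logDeriv_of_leibniz (D := AddMonoidHom.mk' _ dLam_add) (d := AddMonoidHom.mk' _ (dtL_add k))
    dLam_mul (dtL_mul k) h (mul_eq_one_comm.1 h) (map_dLam_map_dtL k M)

end Conjugation

section Vacuum

open MvPowerSeries
open scoped Pointwise

variable {m n : ℕ}

/-- The coefficient of `t^α` in `exp (-∑ t_k)`. -/
def expNegCoeff (α : ℕ →₀ ℕ) : ℂ := (-1) ^ α.degree / α.prod fun _ a => (a.factorial : ℂ)

lemma expNegCoeff_add_single (α : ℕ →₀ ℕ) (k : ℕ) :
    expNegCoeff (α + Finsupp.single k 1) * (α k + 1) = -expNegCoeff α := by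
  have hprod : ((α + Finsupp.single k 1).prod fun _ a => (a.factorial : ℂ)) =
      (α k + 1) * α.prod fun _ a => (a.factorial : ℂ) := by
    rw [← Finsupp.mul_prod_erase' _ k _ (by simp), ← Finsupp.mul_prod_erase' α k _ (by simp),
      Finsupp.erase_add, Finsupp.erase_single, add_zero, Finsupp.add_apply,
      Finsupp.single_eq_same, Nat.factorial_succ]
    push_cast
    ring
  have hk : (α k + 1 : ℂ) ≠ 0 := Nat.cast_add_one_ne_zero _
  have hα : (α.prod fun _ a => (a.factorial : ℂ)) ≠ 0 :=
    Finset.prod_ne_zero_iff.2 fun x _ => Nat.cast_ne_zero.2 (Nat.factorial_ne_zero (α x))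
  rw [expNegCoeff, expNegCoeff, hprod, map_add, Finsupp.degree_single]
  field_simp
  ring

lemma coeff_vacuum (α : ℕ →₀ ℕ) (a b : Idx m n) : coeff α (vacuum m n a b) =
    expNegCoeff α • (J m n ^ (α.sum fun k a => (2 * k + 1) * a)) a b := rfl

lemma JL_pow (k : ℕ) : JL m n ^ k = (J m n ^ k).map ofLoop :=
  (map_pow ofLoop.mapMatrix (J m n) k).symm

lemma coeff_JL_pow_mul_vacuum (p : ℕ) (α : ℕ →₀ ℕ) (a b : Idx m n) :
    coeff α ((JL m n ^ p * vacuum m n) a b) =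
      expNegCoeff α • (J m n ^ (p + α.sum fun k a => (2 * k + 1) * a)) a b := by
  rw [JL_pow, Matrix.mul_apply, map_sum, pow_add, Matrix.mul_apply, Finset.smul_sum]
  refine Finset.sum_congr rfl fun c _ => ?_
  rw [Matrix.map_apply, ofLoop, coeff_C_mul, coeff_vacuum, ← HahnSeries.C_mul_eq_smul,
    ← HahnSeries.C_mul_eq_smul, mul_left_comm]

lemma map_dtL_vacuum (k : ℕ) :
    (vacuum m n).map (dtL k) = -(JL m n ^ (2 * k + 1) * vacuum m n) := by
  ext1 a b
  ext1 α
  ext e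
  have hsum : ((α + Finsupp.single k 1).sum fun k a => (2 * k + 1) * a) =
      (2 * k + 1) + α.sum fun k a => (2 * k + 1) * a := by
    rw [Finsupp.sum_add_index' (by simp) (by intros; ring), Finsupp.sum_single_index (by simp)]
    ring
  rw [Matrix.map_apply, coeff_dtL, coeff_vacuum, hsum, Matrix.neg_apply, map_neg,
    coeff_JL_pow_mul_vacuum, HahnSeries.coeff_neg, HahnSeries.coeff_smul, HahnSeries.coeff_smul,
    smul_eq_mul, smul_eq_mul, mul_right_comm, expNegCoeff_add_single, neg_mul]

lemma map_dtL_JL_pow (k p : ℕ) : (JL m n ^ p).map (dtL k) = 0 := by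
  rw [JL_pow, map_dtL_ofLoop]

lemma map_bMat {R S : Type} [CommRing R] [CommRing S] (φ : R →+* S) :
    (bMat m n R).map φ = bMat m n S := by
  rw [bMat, bMat, fromBlocks_map]
  congr 1
  any_goals exact Matrix.map_zero _ (map_zero φ)
  exact (map_sum φ.mapMatrix _ _).trans
    (Finset.sum_congr rfl fun i _ => (Matrix.map_single ..).trans (by rw [map_one]))

lemma JL_eq : JL m n = single (Sum.inr 0) (Sum.inr (Fin.last _)) (lamPow (-1)) +
    (bMat m n Fun).map ofFun := by
  rw [JL, J, Matrix.map_add _ (map_add ofLoop), map_bMat, map_bMat, Matrix.map_single]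
  rfl

lemma map_dLam_JL : (JL m n).map dLam = single (Sum.inr 0) (Sum.inr (Fin.last _)) 1 := by
  rw [JL_eq, Matrix.map_add _ dLam_add, map_dLam_ofFun, add_zero]
  exact (Matrix.map_single _ _ _ (AddMonoidHom.mk' _ dLam_add)).trans
    (congrArg _ dLam_lamPow_neg_one)

lemma entriesSuppIn_single {s : Set ℤ} {x : LFun} (h : SuppIn s x) (a b : Idx m n) :
    EntriesSuppIn s (single a b x) := fun c d => by
  rw [Matrix.single_apply]
  split_ifs
  exacts [h, SuppIn.zero]

lemma entriesSuppIn_JL_pow (k : ℕ) : EntriesSuppIn (Set.Iic 0) (JL m n ^ k) := by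
  have h0 : (0 : Set ℤ) ⊆ Set.Iic 0 := by simp
  induction k with
  | zero => exact entriesSuppIn_one.mono h0
  | succ k ih =>
    have hJ : EntriesSuppIn (Set.Iic 0) (JL m n) := by
      rw [JL_eq]
      exact (entriesSuppIn_single ((suppIn_lamPow _).mono (by simp)) _ _).add
        ((entriesSuppIn_ofFun _).mono h0)
    exact ih.mul_Iic hJ

end Vacuum

section Twisted

open MvPowerSeries
open scoped Pointwise

variable {m n : ℕ}

lemma entriesSuppIn_twistC : EntriesSuppIn 0 (twistC m n) := by
  have hone : SuppIn 0 (1 : LFun) := suppIn_one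
  have hpow (k : ℕ) : SuppIn 0 ((-1 : LFun) ^ k) := by
    simpa only [map_pow, map_neg, map_one] using suppIn_ofFun ((-1) ^ k)
  have hsingle {I : Type} [DecidableEq I] {x : LFun} (hx : SuppIn 0 x) (a b c d : I) :
      SuppIn 0 (single a b x c d) := by
    rw [Matrix.single_apply]
    split_ifs
    exacts [hx, SuppIn.zero]
  rintro (a | a) (b | b)
  · rw [twistC, fromBlocks_apply₁₁, Matrix.sum_apply]
    exact SuppIn.sum fun i _ => (hsingle hone _ _ _ _).add (hsingle hone _ _ _ _)
  · exact SuppIn.zero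
  · exact SuppIn.zero
  · rw [twistC, fromBlocks_apply₂₂, Matrix.sum_apply]
    exact SuppIn.sum fun i _ => hsingle (hpow _) _ _ _ _

lemma Twisted.mul_inv {g : Mat m n LFun} (h : Twisted g) : g * g⁻¹ = 1 :=
  Matrix.mul_nonsing_inv g (Matrix.isUnit_det_of_right_inverse h)

lemma Twisted.entriesSuppIn_inv {g : Mat m n LFun} (h : Twisted g) {s : Set ℤ}
    (hs : EntriesSuppIn s g) : EntriesSuppIn s g⁻¹ := by
  rw [Matrix.inv_eq_right_inv h]
  have hflip : EntriesSuppIn s (g.map flip)ᵀ := fun a b => (hs b a).flip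
  simpa only [zero_add, add_zero] using
    (entriesSuppIn_twistC.mul hflip).mul entriesSuppIn_twistC

namespace InMinus

variable {g : Mat m n LFun}

lemma entriesSuppIn_sub_one (h : InMinus g) : EntriesSuppIn (Set.Ici 1) (g - 1) := by
  have hone : (1 : Mat m n LFun).map plus = 1 :=
    map_plus_eq_self_iff.2 (entriesSuppIn_one.mono (by simp))
  rw [← map_plus_eq_zero_iff, Matrix.map_sub _ plus_sub, h.plus_eq, hone, sub_self]

lemma entriesSuppIn (h : InMinus g) : EntriesSuppIn (Set.Ici 0) g := by
  have := (h.entriesSuppIn_sub_one.mono (Set.Ici_subset_Ici.2 zero_le_one)).add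
    (entriesSuppIn_one.mono (by simp))
  rwa [sub_add_cancel] at this

lemma entriesSuppIn_map_dtL (h : InMinus g) (k : ℕ) :
    EntriesSuppIn (Set.Ici 1) (g.map (dtL k)) := by
  have := h.entriesSuppIn_sub_one.dtL k
  rwa [Matrix.map_sub _ (dtL_sub k), map_dtL_one, sub_zero] at this

lemma entriesSuppIn_map_dLam (h : InMinus g) : EntriesSuppIn (Set.Ici 2) (g.map dLam) :=
  fun a b => (h.entriesSuppIn a b).dLam

lemma entriesSuppIn_logDeriv (h : InMinus g) (k : ℕ) :
    EntriesSuppIn (Set.Ici 1) (g.map (dtL k) * g⁻¹) :=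
  (h.entriesSuppIn_map_dtL k).mul_Ici (h.twisted.entriesSuppIn_inv h.entriesSuppIn)

lemma entriesSuppIn_map_dLam_mul_inv (h : InMinus g) :
    EntriesSuppIn (Set.Ici 2) (g.map dLam * g⁻¹) :=
  h.entriesSuppIn_map_dLam.mul_Ici (h.twisted.entriesSuppIn_inv h.entriesSuppIn)

end InMinus

lemma InPlus.entriesSuppIn_logDeriv {g : Mat m n LFun} (h : InPlus g) (k : ℕ) :
    EntriesSuppIn (Set.Iic 0) (g.map (dtL k) * g⁻¹) := by
  have hg := map_plus_eq_self_iff.1 h.plus_eq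
  exact (hg.dtL k).mul_Iic (h.twisted.entriesSuppIn_inv hg)

end Twisted

namespace IsTau

open MvPowerSeries

variable {m n : ℕ} {f : Mat m n (LaurentSeries ℂ)} {M E : Mat m n LFun} {τ : Fun}

lemma map_dtL_inv_f (h : IsTau f M E τ) (k : ℕ) :
    ((f.map ofLoop)⁻¹ : Mat m n LFun).map (dtL k) = 0 := by
  rw [map_dtL_inv k h.f_mem.twisted.mul_inv, map_dtL_ofLoop, mul_zero, zero_mul, neg_zero]

lemma logDeriv_E (h : IsTau f M E τ) (k : ℕ) : E.map (dtL k) * E⁻¹ =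
    M.map (dtL k) * M⁻¹ - M * JL m n ^ (2 * k + 1) * M⁻¹ := by
  have hM := h.M_mem.twisted.mul_inv
  have hE : E = M * (vacuum m n * (f.map ofLoop)⁻¹) := by
    rw [h.factor, ← mul_assoc, hM, one_mul]
  have hdE : E.map (dtL k) =
      (M.map (dtL k) * M⁻¹ - M * JL m n ^ (2 * k + 1) * M⁻¹) * E := by
    have hM' (B : Mat m n LFun) : M⁻¹ * (M * B) = B := by
      rw [← mul_assoc, mul_eq_one_comm.1 hM, one_mul]
    rw [hE, map_dtL_mul, map_dtL_mul, h.map_dtL_inv_f, map_dtL_vacuum]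
    simp only [Matrix.sub_mul, Matrix.neg_mul, Matrix.mul_neg, mul_assoc, hM', mul_zero, add_zero,
      ← sub_eq_add_neg]
  rw [hdE, mul_assoc, h.E_mem.twisted.mul_inv, mul_one]

lemma map_plus_conj_JL_pow (h : IsTau f M E τ) (k : ℕ) :
    (M * JL m n ^ (2 * k + 1) * M⁻¹).map plus =
      M * JL m n ^ (2 * k + 1) * M⁻¹ - M.map (dtL k) * M⁻¹ := by
  have hE := map_plus_eq_self_iff.2 (h.E_mem.entriesSuppIn_logDeriv k)
  rw [h.logDeriv_E, Matrix.map_sub _ plus_sub,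
    map_plus_eq_zero_iff.2 (h.M_mem.entriesSuppIn_logDeriv k), zero_sub] at hE
  rw [← neg_sub, ← hE, neg_neg]

lemma map_plus_conj_JL (h : IsTau f M E τ) :
    (M * JL m n * M⁻¹).map plus = M * JL m n * M⁻¹ - M.map (dtL 0) * M⁻¹ := by
  simpa only [mul_zero, zero_add, pow_one] using h.map_plus_conj_JL_pow 0

lemma dt_mul_inv (h : IsTau f M E τ) (k : ℕ) : dt k τ * τ⁻¹ =
    -coeffLam (-1) (M.map dLam * M⁻¹ * (M * JL m n ^ (2 * k + 1) * M⁻¹)).trace := by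
  have hM := h.M_mem.twisted.mul_inv
  have hM' := mul_eq_one_comm.1 hM
  have hcentral : 0 = dt k τ * τ⁻¹ + coeffLam (-1) (-(M.map dLam * M⁻¹) *
      (M.map (dtL k) * M⁻¹ - M * JL m n ^ (2 * k + 1) * M⁻¹)).trace := by
    have hconn := congrFun (congrArg ExtLoop.conn h.lift_eq) k
    have hzero : coeffLam (-1) (0 : LFun) = 0 := rfl
    have hone : (1 : Mat m n LFun).map dLam = 0 := by
      simpa only [Matrix.map_one _ (map_zero ofFun) (map_one ofFun)] using
        map_dLam_ofFun (1 : Mat m n Fun)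
    simp only [ExtLoop.mul, ExtLoop.lift, ExtLoop.scalar, ExtLoop.logDeriv, ExtAlg.Ad, pairing,
      h.map_dtL_inv_f, h.logDeriv_E, hone, one_mul, mul_zero, zero_mul, Matrix.trace_zero, hzero,
      Pi.zero_apply, add_zero, zero_add] at hconn
    rwa [Matrix.inv_eq_right_inv hM', map_dLam_inv hM, Matrix.mul_neg, mul_assoc M⁻¹,
      ← mul_assoc M, hM, one_mul] at hconn
  have hres : coeffLam (-1) (M.map dLam * M⁻¹ * (M.map (dtL k) * M⁻¹)).trace = 0 :=
    coeffLam_eq_zero (h.M_mem.entriesSuppIn_map_dLam_mul_inv.mul_Ici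
      (h.M_mem.entriesSuppIn_logDeriv k)).trace (by simp)
  rw [Matrix.neg_mul, mul_sub, neg_sub, sub_eq_add_neg, Matrix.trace_add, Matrix.trace_neg,
    coeffLam_add, coeffLam_neg, hres, neg_zero, add_zero] at hcentral
  exact eq_neg_of_add_eq_zero_left hcentral.symm

lemma trace_map_dLam_map_plus_mul (h : IsTau f M E τ) (p : ℕ) :
    (((M * JL m n * M⁻¹).map plus).map dLam * (M * JL m n ^ p * M⁻¹)).trace =
      ((JL m n).map dLam * JL m n ^ p).trace -
        ((M.map dLam * M⁻¹ * (M * JL m n ^ p * M⁻¹)).map (dtL 0)).trace := by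
  have hM := h.M_mem.twisted.mul_inv
  have hM' (B : Mat m n LFun) : M⁻¹ * (M * B) = B := by
    rw [← mul_assoc, mul_eq_one_comm.1 hM, one_mul]
  have hcomm : M * JL m n * M⁻¹ * (M * JL m n ^ p * M⁻¹) =
      M * JL m n ^ p * M⁻¹ * (M * JL m n * M⁻¹) := by
    simp only [mul_assoc, hM']
    rw [← mul_assoc (JL m n), ← mul_assoc (JL m n ^ p), ← pow_succ, ← pow_succ']
  have hconj : (M * (JL m n).map dLam * M⁻¹ * (M * JL m n ^ p * M⁻¹)).trace =
      ((JL m n).map dLam * JL m n ^ p).trace := by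
    rw [mul_assoc, mul_assoc, Matrix.trace_mul_comm, mul_assoc M, hM']
    simp only [mul_assoc, mul_eq_one_comm.1 hM, mul_one]
  rw [h.map_plus_conj_JL, Matrix.map_sub _ dLam_sub, map_dLam_conj hM, map_dLam_logDeriv 0 hM,
    trace_zeroCurvature_mul hcomm, hconj, map_dtL_mul 0 (M.map dLam * M⁻¹), map_dtL_mul,
    map_dtL_conj 0 hM (map_dtL_JL_pow 0 p)]

lemma logTau₂_eq (h : IsTau f M E τ) (k : ℕ) :
    logTau₂ τ 0 k = coeffLam (-1) (((M * JL m n * M⁻¹).map plus).map dLam *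
      (M * JL m n ^ (2 * k + 1) * M⁻¹)).trace := by
  have hres : coeffLam (-1) ((JL m n).map dLam * JL m n ^ (2 * k + 1)).trace = 0 := by
    rw [map_dLam_JL]
    refine coeffLam_eq_zero (s := Set.Iic (0 + 0)) (EntriesSuppIn.trace (.mul_Iic ?_
      (entriesSuppIn_JL_pow _))) (by simp)
    exact entriesSuppIn_single (suppIn_one.mono (by simp)) _ _
  have htrace (A : Mat m n LFun) : dtL 0 A.trace = (A.map (dtL 0)).trace :=
    AddMonoidHom.map_trace (AddMonoidHom.mk' _ (dtL_add 0)) A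
  have hneg (a : Fun) : dt 0 (-a) = -dt 0 a := map_neg _ a
  rw [h.trace_map_dLam_map_plus_mul, sub_eq_add_neg, coeffLam_add, coeffLam_neg, hres, zero_add,
    ← htrace, ← dt_coeffLam, logTau₂, h.dt_mul_inv, hneg]

end IsTau

lemma IsGauge.det_eq {m n : ℕ} {Δ : Mat m n Fun} (h : IsGauge Δ) : Δ.det = 1 := by
  obtain ⟨D, rfl, hdiag, hlower⟩ := h
  rw [Matrix.det_fromBlocks_zero₂₁, Matrix.det_one, one_mul,
    Matrix.det_of_isUpperTriangular fun a b hab => hlower a b hab]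
  exact Finset.prod_eq_one fun a _ => hdiag a

lemma IsGauge.mul_inv {m n : ℕ} {Δ : Mat m n Fun} (h : IsGauge Δ) :
    Δ.map ofFun * (Δ.map ofFun)⁻¹ = 1 := by
  have hdet : (Δ.map ofFun).det = 1 := by
    rw [← RingHom.mapMatrix_apply, ← RingHom.map_det, h.det_eq, map_one]
  exact Matrix.mul_nonsing_inv _ (hdet ▸ isUnit_one)

/-! ### Dressing of the connection `∂_x + J` -/

section Dressing

open scoped Pointwise

variable {m n : ℕ}

/-- The loop `H` conjugates `∂_x + J` into `∂_x + J + u`, and is a gauge matrix `Δ` up to negative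
powers of `λ`. -/
structure IsDressing (v : Fields m n) (Δ : Mat m n Fun) (H : Mat m n LFun) : Prop where
  gauge : IsGauge Δ
  sub_gauge : EntriesSuppIn (Set.Ici 1) (H - Δ.map ofFun)
  map_dtL : H.map (dtL 0) = H * JL m n - (JL m n + v.toMat.map ofFun) * H

lemma InMinus.gauge_mul_sub {M : Mat m n LFun} (hM : InMinus M) (Δ : Mat m n Fun) :
    EntriesSuppIn (Set.Ici 1) (Δ.map ofFun * M - Δ.map ofFun) := by
  have := (entriesSuppIn_ofFun Δ).mul hM.entriesSuppIn_sub_one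
  rwa [zero_add, mul_sub, mul_one] at this

lemma map_dtL_conj_of_dressing {I : Type*} [Fintype I] [DecidableEq I] (k : ℕ)
    {H G L V Q : Matrix I I LFun} (hG : H * G = 1) (hH : H.map (dtL k) = H * L - V * H)
    (hL : L * Q = Q * L) (hQ : Q.map (dtL k) = 0) :
    (H * Q * G).map (dtL k) = H * Q * G * V - V * (H * Q * G) := by
  have hGH (B : Matrix I I LFun) : G * (H * B) = B := by
    rw [← mul_assoc, mul_eq_one_comm.1 hG, one_mul]
  have hHG : H.map (dtL k) * G = H * L * G - V := by
    rw [hH, Matrix.sub_mul, mul_assoc V, hG, mul_one]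
  have hcomm : H * L * G * (H * Q * G) = H * Q * G * (H * L * G) := by
    simp only [mul_assoc, hGH]
    rw [← mul_assoc L, hL, mul_assoc]
  rw [map_dtL_conj k hG hQ, hHG, Matrix.sub_mul, Matrix.mul_sub, hcomm, sub_sub_sub_cancel_left]

variable {f : Mat m n (LaurentSeries ℂ)} {M E : Mat m n LFun} {τ : Fun} {v : Fields m n}

lemma IsTau.isDressing (h : IsTau f M E τ) {Δ : Mat m n Fun} (hΔ : IsGauge Δ)
    (hatt : Δ.map ofFun * (M * JL m n * M⁻¹).map plus - (Δ.map ofFun).map (dtL 0) =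
      (JL m n + v.toMat.map ofFun) * Δ.map ofFun) : IsDressing v Δ (Δ.map ofFun * M) where
  gauge := hΔ
  sub_gauge := h.M_mem.gauge_mul_sub Δ
  map_dtL := by
    have hM' : M⁻¹ * M = 1 := mul_eq_one_comm.1 h.M_mem.twisted.mul_inv
    rw [map_dtL_mul, ← mul_assoc (JL m n + _), ← hatt, h.map_plus_conj_JL, Matrix.mul_sub,
      Matrix.sub_mul, Matrix.sub_mul]
    simp only [mul_assoc, hM', mul_one]
    abel

lemma map_dLam_map_plus_of_attached {A : Mat m n LFun} {Δ : Mat m n Fun} (hΔ : IsGauge Δ)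
    (hatt : Δ.map ofFun * A - (Δ.map ofFun).map (dtL 0) =
      (JL m n + v.toMat.map ofFun) * Δ.map ofFun) :
    A.map dLam = (Δ.map ofFun)⁻¹ * single (.inr 0) (.inr (Fin.last _)) 1 * Δ.map ofFun := by
  have hdLam := congrArg (fun B : Mat m n LFun => B.map dLam) hatt
  have hΔx : ((Δ.map ofFun).map (dtL 0)).map dLam = 0 := by
    rw [map_dLam_map_dtL, map_dLam_ofFun]
    exact Matrix.map_zero _ (map_zero (AddMonoidHom.mk' _ (dtL_add 0)))
  simp only [Matrix.map_sub _ dLam_sub, Matrix.map_add _ dLam_add, map_dLam_mul, map_dLam_ofFun,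
    hΔx, map_dLam_JL, zero_mul, mul_zero, zero_add, add_zero, sub_zero] at hdLam
  rw [mul_assoc, ← hdLam, ← mul_assoc, mul_eq_one_comm.1 hΔ.mul_inv, one_mul]

lemma IsTau.exists_isDressing (h : IsTau f M E τ) (hv : IsAttached M v) :
    ∃ (Δ : Mat m n Fun) (H : Mat m n LFun), IsDressing v Δ H ∧ ∀ k, logTau₂ τ 0 k =
      coeffLam (-1) ((H * JL m n ^ (2 * k + 1) * H⁻¹) (.inr (Fin.last _)) (.inr 0)) := by
  obtain ⟨Δ, hΔ, hatt⟩ := hv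
  refine ⟨Δ, Δ.map ofFun * M, h.isDressing hΔ hatt, fun k => ?_⟩
  rw [h.logTau₂_eq, map_dLam_map_plus_of_attached hΔ hatt, Matrix.mul_inv_rev, mul_assoc, mul_assoc,
    Matrix.trace_mul_comm, mul_assoc, Matrix.trace_single_mul, one_smul]
  simp only [mul_assoc]

end Dressing

/-! ### Power series in `λ⁻¹` and the principal grading -/

section Series

open MvPowerSeries

/-- The series in the loop parameter formed by the coefficients at `t^α` of a series over the formal
functions. -/
def coeffSeries (α : ℕ →₀ ℕ) : PowerSeries Fun →+ PowerSeries ℂ where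
  toFun a := PowerSeries.mk fun i => coeff α (PowerSeries.coeff i a)
  map_zero' := by ext i; simp
  map_add' a b := by ext i; simp

lemma coeff_coeffSeries (α : ℕ →₀ ℕ) (a : PowerSeries Fun) (i : ℕ) :
    PowerSeries.coeff i (coeffSeries α a) = coeff α (PowerSeries.coeff i a) :=
  PowerSeries.coeff_mk i fun i => coeff α (PowerSeries.coeff i a)

lemma coeffSeries_C (α : ℕ →₀ ℕ) (a : Fun) :
    coeffSeries α (PowerSeries.C a) = PowerSeries.C (coeff α a) := by
  ext i
  rw [coeff_coeffSeries, PowerSeries.coeff_C, PowerSeries.coeff_C]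
  split_ifs
  exacts [rfl, map_zero _]

lemma coeffSeries_mul (α : ℕ →₀ ℕ) (a b : PowerSeries Fun) :
    coeffSeries α (a * b) =
      ∑ p ∈ Finset.HasAntidiagonal.antidiagonal α, coeffSeries p.1 a * coeffSeries p.2 b := by
  ext i
  simp only [coeff_coeffSeries, PowerSeries.coeff_mul, map_sum, coeff_mul]
  exact Finset.sum_comm

/-- The function underlying `ofSeries`. -/
def ofSeriesFun (a : PowerSeries Fun) : LFun :=
  fun α => HahnSeries.ofPowerSeries ℤ ℂ (coeffSeries α a)

lemma coeff_ofSeriesFun (a : PowerSeries Fun) (α : ℕ →₀ ℕ) :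
    coeff α (ofSeriesFun a) = HahnSeries.ofPowerSeries ℤ ℂ (coeffSeries α a) := rfl

/-- A power series over the formal functions as a loop, its variable standing for `λ⁻¹`. -/
def ofSeries : PowerSeries Fun →+* LFun where
  toFun := ofSeriesFun
  map_one' := by
    ext1 α
    rw [coeff_ofSeriesFun, ← map_one PowerSeries.C, coeffSeries_C, HahnSeries.ofPowerSeries_C,
      ← map_one ofFun, ofFun, coeff_map]
  map_zero' := by
    ext1 α
    rw [coeff_ofSeriesFun, map_zero, map_zero, map_zero]
  map_add' a b := by
    ext1 α
    rw [map_add, coeff_ofSeriesFun, coeff_ofSeriesFun, coeff_ofSeriesFun, map_add, map_add]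
  map_mul' a b := by
    ext1 α
    rw [coeff_mul, coeff_ofSeriesFun, coeffSeries_mul, map_sum]
    exact Finset.sum_congr rfl fun p _ => map_mul _ _ _

lemma coeff_ofSeries (a : PowerSeries Fun) (α : ℕ →₀ ℕ) :
    coeff α (ofSeries a) = HahnSeries.ofPowerSeries ℤ ℂ (coeffSeries α a) := rfl

lemma coeff_ofSeries_natCast (a : PowerSeries Fun) (α : ℕ →₀ ℕ) (i : ℕ) :
    (coeff α (ofSeries a)).coeff (i : ℤ) = coeff α (PowerSeries.coeff i a) := by
  rw [coeff_ofSeries, HahnSeries.ofPowerSeries_apply_coeff, coeff_coeffSeries]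

lemma suppIn_ofSeries (a : PowerSeries Fun) : SuppIn (Set.Ici 0) (ofSeries a) := fun α e he => by
  rw [coeff_ofSeries, PowerSeries.coeff_coe, if_pos (by simpa using he)]

lemma coeffLam_ofSeries (a : PowerSeries Fun) (i : ℕ) :
    coeffLam (-i) (ofSeries a) = PowerSeries.coeff i a := by
  ext1 α
  rw [coeff_coeffLam, neg_neg, coeff_ofSeries_natCast]

lemma ofSeries_ext {a : PowerSeries Fun} {b : LFun} (hb : SuppIn (Set.Ici 0) b)
    (h : ∀ i : ℕ, PowerSeries.coeff i a = coeffLam (-i) b) : ofSeries a = b := by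
  ext α e
  by_cases he : 0 ≤ e
  · obtain ⟨i, rfl⟩ := Int.eq_ofNat_of_zero_le he
    rw [coeff_ofSeries_natCast, h, coeff_coeffLam, neg_neg]
  · rw [suppIn_ofSeries a α e (by simpa using he), hb α e (by simpa using he)]

lemma ofSeries_injective : Function.Injective ofSeries := fun a b h => by
  ext1 i
  rw [← coeffLam_ofSeries, h, coeffLam_ofSeries]

/-- The series in `λ⁻¹` of the coefficients of the nonpositive powers of `λ`. -/
def toSeries (b : LFun) : PowerSeries Fun := PowerSeries.mk fun i => coeffLam (-i) b

lemma ofSeries_toSeries {b : LFun} (hb : SuppIn (Set.Ici 0) b) : ofSeries (toSeries b) = b :=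
  ofSeries_ext hb fun _ => PowerSeries.coeff_mk _ _

lemma ofSeries_C (a : Fun) : ofSeries (PowerSeries.C a) = ofFun a := by
  ext1 α
  rw [coeff_ofSeries, coeffSeries_C, HahnSeries.ofPowerSeries_C]
  exact (coeff_map _ _ _).symm

lemma ofSeries_X : ofSeries PowerSeries.X = lamPow 1 := by
  ext1 α
  have hX : coeffSeries α PowerSeries.X = PowerSeries.X * PowerSeries.C (coeff α (1 : Fun)) := by
    rw [← coeffSeries_C, map_one]
    ext i
    rcases i with _ | i
    · simp [coeff_coeffSeries]
    · simp [coeff_coeffSeries, PowerSeries.coeff_X, PowerSeries.coeff_one,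
        PowerSeries.coeff_succ_X_mul]
  classical
  rw [coeff_ofSeries, hX, map_mul, HahnSeries.ofPowerSeries_X, lamPow, ofLoop, coeff_C, coeff_one,
    HahnSeries.ofPowerSeries_C]
  split_ifs <;> simp

lemma dtL_ofSeries (k : ℕ) (a : PowerSeries Fun) :
    dtL k (ofSeries a) = ofSeries (coeffwise (dt k) a) := by
  refine (ofSeries_ext ((suppIn_ofSeries a).dtL k) fun i => ?_).symm
  rw [coeff_coeffwise, ← dt_coeffLam, coeffLam_ofSeries]

lemma coeffLam_lamPow_mul (i e : ℤ) (a : LFun) :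
    coeffLam i (lamPow e * a) = coeffLam (i + e) a := by
  ext1 α
  rw [coeff_coeffLam, coeff_lamPow_mul, coeff_coeffLam, neg_add']

end Series

section Subst

open MvPowerSeries

/-- The substitution of `λ^(2n+1)` for `λ`. -/
def subst (n : ℕ) : LFun →+* LFun :=
  MvPowerSeries.map (HahnSeries.embDomainRingHom (AddMonoidHom.mulLeft ((2 * n + 1 : ℕ) : ℤ))
    (fun _ _ => mul_left_cancel₀ (Nat.cast_ne_zero.2 (2 * n).succ_ne_zero))
    fun _ _ => mul_le_mul_iff_right₀ (Nat.cast_pos.2 (2 * n).succ_pos))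

variable {n : ℕ}

lemma coeff_subst (a : LFun) (α : ℕ →₀ ℕ) (e : ℤ) :
    (coeff α (subst n a)).coeff ((2 * n + 1 : ℕ) * e) = (coeff α a).coeff e := by
  rw [subst, coeff_map]
  exact HahnSeries.embDomain_coeff

lemma coeff_subst_of_not_dvd (a : LFun) (α : ℕ →₀ ℕ) {e : ℤ} (he : ¬((2 * n + 1 : ℕ) : ℤ) ∣ e) :
    (coeff α (subst n a)).coeff e = 0 := by
  rw [subst, coeff_map]
  refine HahnSeries.embDomain_of_notMem_range ?_
  rintro ⟨e', rfl⟩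
  exact he (dvd_mul_right _ _)

lemma coeffLam_subst (a : LFun) (i : ℤ) :
    coeffLam ((2 * n + 1 : ℕ) * i) (subst n a) = coeffLam i a := by
  ext1 α
  rw [coeff_coeffLam, coeff_coeffLam, ← mul_neg, coeff_subst]

lemma subst_injective : Function.Injective (subst n) := fun a b h => by
  ext α e
  rw [← coeff_subst (n := n), h, coeff_subst]

lemma dtL_subst (k : ℕ) (a : LFun) : dtL k (subst n a) = subst n (dtL k a) := by
  ext α e
  rw [coeff_dtL]
  by_cases he : ((2 * n + 1 : ℕ) : ℤ) ∣ e
  · obtain ⟨e', rfl⟩ := he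
    rw [coeff_subst, coeff_subst, coeff_dtL]
  · rw [coeff_subst_of_not_dvd _ _ he, coeff_subst_of_not_dvd _ _ he, zero_mul]

lemma subst_ofFun (a : Fun) : subst n (ofFun a) = ofFun a := by
  ext1 α
  rw [subst, coeff_map, ofFun, coeff_map]
  exact HahnSeries.embDomainRingHom_C

lemma subst_lamPow (e : ℤ) : subst n (lamPow e) = lamPow ((2 * n + 1 : ℕ) * e) := by
  rw [subst, lamPow, ofLoop, MvPowerSeries.map_C]
  exact congrArg _ HahnSeries.embDomain_single

lemma SuppIn.subst {a : LFun} (h : SuppIn (Set.Ici 1) a) :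
    SuppIn (Set.Ici ((2 * n + 1 : ℕ) : ℤ)) (subst n a) := fun α e he => by
  by_cases hd : ((2 * n + 1 : ℕ) : ℤ) ∣ e
  · obtain ⟨e', rfl⟩ := hd
    rw [coeff_subst]
    exact h _ _ fun he' => he <| Set.mem_Ici.2 <|
      le_mul_of_one_le_right (Nat.cast_nonneg _) (Set.mem_Ici.1 he')
  · exact coeff_subst_of_not_dvd _ _ hd

end Subst

section Principal

open scoped Pointwise

variable {m n : ℕ}

/-- The passage to the principal grading: the substitution of `λ^(2n+1)` for `λ`, followed by
conjugation with `diag(λ^pos)`. -/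
def principal : Mat m n LFun →+* Mat m n LFun where
  toFun A := Matrix.of fun a b => lamPow (pos b - pos a) * subst n (A a b)
  map_one' := by
    ext1 a b
    rw [Matrix.of_apply, Matrix.one_apply]
    split_ifs with h
    · rw [h, sub_self, lamPow_zero, map_one, mul_one]
    · rw [map_zero, mul_zero]
  map_zero' := by ext1 a b; simp
  map_add' A A' := by ext1 a b; simp [mul_add]
  map_mul' A A' := by
    ext1 a b
    simp only [Matrix.of_apply, Matrix.mul_apply, map_sum, map_mul, Finset.mul_sum]
    refine Finset.sum_congr rfl fun c _ => ?_
    rw [mul_mul_mul_comm, lamPow_mul, sub_add_sub_cancel']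

lemma principal_apply (A : Mat m n LFun) (a b : Idx m n) :
    principal A a b = lamPow (pos b - pos a) * subst n (A a b) := rfl

lemma principal_injective : Function.Injective (principal (m := m) (n := n)) := fun A A' h => by
  ext1 a b
  have hab := congrArg (lamPow (pos a - pos b) * ·) (congrFun₂ h a b)
  simp only [principal_apply, ← mul_assoc, lamPow_mul, sub_add_sub_cancel, sub_self, lamPow_zero,
    one_mul] at hab
  exact subst_injective hab

lemma principal_map_dtL (A : Mat m n LFun) (k : ℕ) :
    principal (A.map (dtL k)) = (principal A).map (dtL k) := by
  ext1 a b
  rw [Matrix.map_apply, principal_apply, principal_apply, Matrix.map_apply, dtL_mul, lamPow,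
    dtL_ofLoop, zero_mul, zero_add, dtL_subst]

lemma principal_map_ofFun_apply (A : Mat m n Fun) (a b : Idx m n) :
    principal (A.map ofFun) a b = lamPow (pos b - pos a) * ofFun (A a b) := by
  rw [principal_apply, Matrix.map_apply, subst_ofFun]

lemma principal_single (a b : Idx m n) (x : LFun) :
    principal (single a b x) = single a b (lamPow (pos b - pos a) * subst n x) := by
  ext1 c d
  rw [principal_apply, Matrix.single_apply, Matrix.single_apply]
  split_ifs with h
  · rw [h.1, h.2]
  · rw [map_zero, mul_zero]

lemma bMat_eq_sum {R : Type} [CommRing R] :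
    bMat m n R = ∑ i : Fin (2 * n), single (.inr i.succ) (.inr i.castSucc) 1 := by
  ext a b
  rcases a with a | a <;> rcases b with b | b <;>
    simp [bMat, Matrix.sum_apply, Matrix.single_apply]

lemma principal_bMat : principal (bMat m n LFun) = lamPow (-1) • bMat m n LFun := by
  rw [bMat_eq_sum, map_sum, Finset.smul_sum]
  refine Finset.sum_congr rfl fun i _ => ?_
  rw [principal_single, Matrix.smul_single, map_one, mul_one, smul_eq_mul, mul_one]
  simp [pos]

lemma circulant_single_one_eq {R : Type*} [AddCommMonoidWithOne R] {k : ℕ} :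
    circulant (Pi.single 1 1 : Fin (k + 1) → R) =
      single 0 (Fin.last _) 1 + ∑ i : Fin k, single i.succ i.castSucc 1 := by
  ext a b
  rw [circulant_apply, Pi.single_apply, Matrix.add_apply, Matrix.sum_apply]
  simp only [sub_eq_iff_eq_add']
  cases b using Fin.lastCases with
  | last => simp [Matrix.single_apply, eq_comm (a := a), Fin.castSucc_ne_last]
  | cast b =>
    rw [Finset.sum_eq_single b (fun i _ hi => by simp [hi]) (by simp)]
    simp [Matrix.single_apply, Fin.coeSucc_eq_succ, eq_comm (a := a),
      (Fin.castSucc_ne_last b).symm]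

lemma cyc_eq {R : Type} [CommRing R] :
    cyc m n R = single (.inr 0) (.inr (Fin.last _)) 1 + bMat m n R := by
  rw [cyc, circulant_single_one_eq, bMat]
  ext a b
  rcases a with a | a <;> rcases b with b | b <;> simp [Matrix.single_apply]

lemma principal_JL : principal (JL m n) = lamPow (-1) • cyc m n LFun := by
  have hpos : (pos (.inr (Fin.last _) : Idx m n) - pos (.inr 0 : Idx m n) : ℤ) +
      (2 * n + 1 : ℕ) * (-1) = -1 := by
    simp [pos]
  ext1 a b
  rw [JL_eq, map_bMat, map_add, principal_single, subst_lamPow, lamPow_mul, hpos, principal_bMat,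
    cyc_eq, Matrix.add_apply, Matrix.smul_apply, Matrix.smul_apply, Matrix.add_apply,
    smul_eq_mul, smul_eq_mul, mul_add, Matrix.single_apply, Matrix.single_apply, mul_ite, mul_one,
    mul_zero]

lemma principal_ofFun {A : Mat m n Fun} (h : A.BlockTriangular pos) :
    lamPow 1 • principal (A.map ofFun) = ofSeries.mapMatrix (scaled m n Fun A) := by
  ext1 a b
  rw [Matrix.smul_apply, principal_map_ofFun_apply, RingHom.mapMatrix_apply, Matrix.map_apply,
    scaled_apply, map_mul, map_pow, ofSeries_X, ofSeries_C, lamPow_pow, smul_eq_mul]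
  by_cases hab : pos b < pos a
  · simp [h hab]
  · rw [← mul_assoc, lamPow_mul, Nat.cast_sub (by omega), Nat.cast_succ, mul_one]
    congr 2
    ring

lemma EntriesSuppIn.principal {A : Mat m n LFun} (h : EntriesSuppIn (Set.Ici 1) A) :
    EntriesSuppIn (Set.Ici 1) (principal A) := fun a b => by
  refine ((suppIn_lamPow _).mul (h a b).subst).mono ?_
  rintro _ ⟨_, rfl, j, hj, rfl⟩
  have := pos_le a
  simp only [Set.mem_Ici] at hj ⊢
  omega

lemma IsGauge.sub_one_apply {Δ : Mat m n Fun} (hΔ : IsGauge Δ) {a b : Idx m n}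
    (hab : pos b ≤ pos a) : (Δ - 1) a b = 0 := by
  obtain ⟨D, rfl, hdiag, hlower⟩ := hΔ
  rw [Matrix.sub_apply]
  rcases a with a | a <;> rcases b with b | b
  iterate 3 simp [Matrix.one_apply]
  rw [fromBlocks_apply₂₂]
  rcases (show b ≤ a from hab).eq_or_lt with rfl | hab
  · rw [hdiag, Matrix.one_apply_eq, sub_self]
  · rw [hlower a b hab, Matrix.one_apply_ne (Sum.inr_injective.ne hab.ne'), sub_self]

lemma IsGauge.principal_sub_one {Δ : Mat m n Fun} (hΔ : IsGauge Δ) :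
    EntriesSuppIn (Set.Ici 1) (principal ((Δ - 1).map ofFun)) := fun a b => by
  rw [principal_map_ofFun_apply]
  by_cases hab : pos b ≤ pos a
  · rw [hΔ.sub_one_apply hab, map_zero, mul_zero]
    exact SuppIn.zero
  · refine ((suppIn_lamPow _).mul (suppIn_ofFun _)).mono ?_
    rw [add_zero, Set.singleton_subset_iff, Set.mem_Ici]
    omega

end Principal

/-! ### The resolvent as a power series -/

section SeriesMatrix

variable {I : Type*} [Fintype I]

lemma smul_add_commutator_eq_zero {R : Type*} [CommRing R] {y : R} {T V W D : Matrix I I R}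
    (hW : W = y • V) (hD : D = T * V - V * T) : y • D + (W * T - T * W) = 0 := by
  rw [hD, hW, smul_sub, smul_mul_assoc, mul_smul_comm]
  abel

lemma commute_smul_self {R : Type*} [CommRing R] (c : R) (A : Matrix I I R) : Commute (c • A) A :=
  (Commute.refl A).smul_left c

variable [DecidableEq I]

lemma mapMatrix_ofSeries_injective : Function.Injective (ofSeries.mapMatrix (m := I)) :=
  fun A A' h => by
    ext1 a b
    exact ofSeries_injective (congrFun₂ h a b)

lemma map_coeffwise_add_commutator_eq_zero {T W : Matrix I I (PowerSeries Fun)} {k : ℕ}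
    {V : Matrix I I LFun} (hW : ofSeries.mapMatrix W = lamPow 1 • V)
    (hT : (ofSeries.mapMatrix T).map (dtL k) =
      ofSeries.mapMatrix T * V - V * ofSeries.mapMatrix T) :
    (PowerSeries.X : PowerSeries Fun) • T.map (coeffwise (dt k)) + (W * T - T * W) = 0 := by
  have hX : ofSeries.mapMatrix ((PowerSeries.X : PowerSeries Fun) • T.map (coeffwise (dt k))) =
      lamPow 1 • (ofSeries.mapMatrix T).map (dtL k) := by
    ext1 a b
    simp [ofSeries_X, dtL_ofSeries]
  refine mapMatrix_ofSeries_injective ?_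
  rw [map_add, hX, map_sub, map_mul, map_mul, map_zero]
  exact smul_add_commutator_eq_zero hW hT

lemma isUnit_of_map_constantCoeff {B : Type*} [CommRing B] {η : Matrix I I (PowerSeries B)}
    (h : IsUnit (η.map PowerSeries.constantCoeff).det) : IsUnit η := by
  rwa [Matrix.isUnit_iff_isUnit_det, PowerSeries.isUnit_iff_constantCoeff, RingHom.map_det]

lemma exists_units_mapMatrix_ofSeries {H : Matrix I I LFun} {c : Matrix I I Fun}
    (hc : IsUnit c.det) (h : EntriesSuppIn (Set.Ici 1) (H - c.map ofFun)) :
    ∃ η : (Matrix I I (PowerSeries Fun))ˣ, ofSeries.mapMatrix ↑η = H ∧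
      ofSeries.mapMatrix ↑η⁻¹ = H⁻¹ ∧
      (η : Matrix I I (PowerSeries Fun)).map PowerSeries.constantCoeff = c := by
  have hsupp : EntriesSuppIn (Set.Ici 0) H := by
    have := (h.mono (Set.Ici_subset_Ici.2 zero_le_one)).add
      ((entriesSuppIn_ofFun c).mono (t := Set.Ici 0) (by simp))
    rwa [sub_add_cancel] at this
  have hH : ofSeries.mapMatrix (H.map toSeries) = H := by
    ext1 a b
    exact ofSeries_toSeries (hsupp a b)
  have hconst : (H.map toSeries).map PowerSeries.constantCoeff = c := by
    ext1 a b
    rw [Matrix.map_apply, ← PowerSeries.coeff_zero_eq_constantCoeff_apply, ← sub_eq_zero,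
      ← PowerSeries.coeff_zero_C (c a b), ← map_sub, ← coeffLam_ofSeries, map_sub, ofSeries_C,
      Matrix.map_apply, ofSeries_toSeries (hsupp a b)]
    exact coeffLam_eq_zero (h a b) (by simp)
  obtain ⟨η, hη⟩ := isUnit_of_map_constantCoeff (η := H.map toSeries) (by rwa [hconst])
  have hηH : ofSeries.mapMatrix ↑η = H := by rw [hη, hH]
  refine ⟨η, hηH, (Matrix.inv_eq_right_inv ?_).symm, by rw [hη, hconst]⟩
  rw [← hηH, ← map_mul, η.mul_inv, map_one]

lemma entriesDvd_conj_sub {B : Type*} [CommRing B] {x : B} {η : (Matrix I I B)ˣ}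
    (h : EntriesDvd x (η.val - 1)) (A : Matrix I I B) :
    EntriesDvd x (η.val * A * η⁻¹.val - A) := by
  have hconj : η.val * A * η⁻¹.val - A = ((η.val - 1) * A - A * (η.val - 1)) * η⁻¹.val := by
    rw [sub_one_mul, mul_sub_one, sub_sub_sub_cancel_right, sub_mul, mul_assoc A, η.mul_inv,
      mul_one]
  rw [hconj]
  exact ((h.mul_right _).sub (h.mul_left _)).mul_right _

lemma mul_smul_pow_mul {R : Type*} [CommRing R] (c : R) (A B C : Matrix I I R) (k : ℕ) :
    A * (c • B) ^ k * C = c ^ k • (A * B ^ k * C) := by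
  rw [smul_pow, mul_smul_comm, smul_mul_assoc]

end SeriesMatrix

section Resolvent

variable {m n : ℕ} {v : Fields m n} {Δ : Mat m n Fun} {H : Mat m n LFun}

lemma mapMatrix_ofSeries_connection (v : Fields m n) :
    ofSeries.mapMatrix (cyc m n _ + scaled m n Fun v.toMat) =
      lamPow 1 • principal (JL m n + v.toMat.map ofFun) := by
  have hU : lamPow 1 • principal (v.toMat.map ofFun) =
      ofSeries.mapMatrix (scaled m n Fun v.toMat) :=
    principal_ofFun (by rw [toMat_eq_potential]; exact blockTriangular_potential _ _ _)
  have hJ : lamPow 1 • principal (JL m n) = cyc m n LFun := by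
    ext1 a b
    rw [principal_JL, Matrix.smul_apply, Matrix.smul_apply, smul_eq_mul, smul_eq_mul, ← mul_assoc,
      lamPow_mul, add_neg_cancel, lamPow_zero, one_mul]
  rw [map_add, map_add, map_cyc, ← hU, ← hJ]
  exact (smul_add (lamPow 1) (principal (JL m n)) _).symm

lemma IsDressing.principal_sub_one (h : IsDressing v Δ H) :
    EntriesSuppIn (Set.Ici 1) (principal H - 1) := by
  have hsplit : H - 1 = (Δ - 1).map ofFun + (H - Δ.map ofFun) := by
    rw [Matrix.map_sub _ (map_sub ofFun), Matrix.map_one _ (map_zero ofFun) (map_one ofFun)]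
    abel
  rw [← map_one principal, ← map_sub, hsplit, map_add]
  exact h.gauge.principal_sub_one.add h.sub_gauge.principal

lemma coeffLam_neg_one_of_principal_eq {A : Mat m n LFun} {S : Mat m n (PowerSeries Fun)} {k : ℕ}
    (h : principal A = lamPow (-(2 * k + 1 : ℕ)) • ofSeries.mapMatrix S) :
    coeffLam (-1) (A (.inr (Fin.last _)) (.inr 0)) =
      PowerSeries.coeff (2 * k + 2) (S (.inr (Fin.last _)) (.inr 0)) := by
  have hentry := congrArg (coeffLam (-1)) (congrFun₂ h (.inr (Fin.last _)) (.inr 0))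
  rw [principal_apply, Matrix.smul_apply, smul_eq_mul, coeffLam_lamPow_mul, coeffLam_lamPow_mul]
    at hentry
  simp only [RingHom.mapMatrix_apply, Matrix.map_apply] at hentry
  rw [← coeffLam_subst (n := n), ← coeffLam_ofSeries]
  convert hentry using 2
  · simp [pos]
  · push_cast; ring

lemma IsDressing.exists_units (h : IsDressing v Δ H) :
    ∃ η : (Mat m n (PowerSeries Fun))ˣ, ofSeries.mapMatrix ↑η = H ∧
      ofSeries.mapMatrix ↑η⁻¹ = H⁻¹ ∧ η.val.map PowerSeries.constantCoeff = Δ :=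
  exists_units_mapMatrix_ofSeries (h.gauge.det_eq ▸ isUnit_one) h.sub_gauge

lemma IsDressing.mul_inv (h : IsDressing v Δ H) : H * H⁻¹ = 1 := by
  obtain ⟨η, hη, hη', -⟩ := h.exists_units
  rw [← hη', ← hη, ← map_mul, η.mul_inv, map_one]

lemma IsDressing.exists_units_principal (h : IsDressing v Δ H) :
    ∃ η : (Mat m n (PowerSeries Fun))ˣ, ofSeries.mapMatrix ↑η = principal H ∧
      ofSeries.mapMatrix ↑η⁻¹ = principal H⁻¹ ∧ EntriesDvd PowerSeries.X (η.val - 1) := by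
  have hone : (1 : Mat m n Fun).map ofFun = 1 :=
    Matrix.map_one _ (map_zero ofFun) (map_one ofFun)
  obtain ⟨η, hη, hη', hη₁⟩ := exists_units_mapMatrix_ofSeries (c := 1) (H := principal H)
    (by simp) (hone ▸ h.principal_sub_one)
  have hinv : (principal H)⁻¹ = principal H⁻¹ :=
    Matrix.inv_eq_right_inv (by rw [← map_mul, h.mul_inv, map_one])
  refine ⟨η, hη, hη'.trans hinv, fun a b => ?_⟩
  have hab : PowerSeries.constantCoeff (η.val a b) = (1 : Mat m n Fun) a b := congrFun₂ hη₁ a b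
  rw [PowerSeries.X_dvd_iff, Matrix.sub_apply, map_sub, hab, Matrix.one_apply, Matrix.one_apply]
  split_ifs <;> simp

lemma principal_conj_JL_pow {η : (Mat m n (PowerSeries Fun))ˣ} {G : Mat m n LFun}
    (hH : ofSeries.mapMatrix ↑η = principal H) (hG : ofSeries.mapMatrix ↑η⁻¹ = principal G)
    (k : ℕ) :
    principal (H * JL m n ^ k * G) =
      lamPow (-k) • ofSeries.mapMatrix ((η.val * cyc m n _ * η⁻¹.val) ^ k) := by
  rw [Units.conj_pow, map_mul, map_mul, map_pow, map_mul, map_mul, map_pow, hH, hG, map_cyc,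
    principal_JL, show (-k : ℤ) = k * -1 by ring, ← lamPow_pow]
  exact mul_smul_pow_mul _ _ _ _ _

variable {f : Mat m n (LaurentSeries ℂ)} {M E : Mat m n LFun} {τ : Fun}

lemma IsDressing.map_coeffwise_conj_cyc (h : IsDressing v Δ H) {η : (Mat m n (PowerSeries Fun))ˣ}
    (hη : ofSeries.mapMatrix ↑η = principal H) (hη' : ofSeries.mapMatrix ↑η⁻¹ = principal H⁻¹) :
    (PowerSeries.X : PowerSeries Fun) •
        (η.val * cyc m n _ * η⁻¹.val).map (coeffwise (dt 0)) +
      ((cyc m n _ + scaled m n Fun v.toMat) * (η.val * cyc m n _ * η⁻¹.val) -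
        η.val * cyc m n _ * η⁻¹.val * (cyc m n _ + scaled m n Fun v.toMat)) = 0 := by
  have hinv : principal H * principal H⁻¹ = 1 := by rw [← map_mul, h.mul_inv, map_one]
  have hdt : (principal H).map (dtL 0) = principal H * principal (JL m n) -
      principal (JL m n + v.toMat.map ofFun) * principal H := by
    rw [← principal_map_dtL, h.map_dtL, map_sub, map_mul, map_mul]
  have hcomm : principal (JL m n) * cyc m n LFun = cyc m n LFun * principal (JL m n) := by
    rw [principal_JL]
    exact commute_smul_self _ _
  have hcyc : (cyc m n LFun).map (dtL 0) = 0 := by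
    rw [← map_cyc ofLoop]
    exact map_dtL_ofLoop 0 _
  refine map_coeffwise_add_commutator_eq_zero (mapMatrix_ofSeries_connection v) ?_
  rw [map_mul, map_mul, hη, hη', map_cyc]
  exact map_dtL_conj_of_dressing 0 hinv hdt hcomm hcyc

theorem IsTau.exists_resolventSeries (h : IsTau f M E τ) (hv : IsAttached M v) :
    ∃ σ : Mat m n (PowerSeries Fun), EntriesDvd PowerSeries.X (σ - cyc m n _) ∧
      σ ^ (2 * n + 1 + 1) = σ ∧
      (PowerSeries.X : PowerSeries Fun) • σ.map (coeffwise (dt 0)) +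
        ((cyc m n _ + scaled m n Fun v.toMat) * σ -
          σ * (cyc m n _ + scaled m n Fun v.toMat)) = 0 ∧
      ∀ k, logTau₂ τ 0 k =
        PowerSeries.coeff (2 * k + 2) ((σ ^ (2 * k + 1)) (.inr (Fin.last _)) (.inr 0)) := by
  obtain ⟨Δ, H, hH, htau⟩ := h.exists_isDressing hv
  obtain ⟨η, hη, hη', hη₁⟩ := hH.exists_units_principal
  refine ⟨η.val * cyc m n _ * η⁻¹.val, entriesDvd_conj_sub hη₁ _, ?_,
    hH.map_coeffwise_conj_cyc hη hη', fun k => ?_⟩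
  · rw [Units.conj_pow, cyc_pow_card_succ]
  · rw [htau, coeffLam_neg_one_of_principal_eq (principal_conj_JL_pow hη hη' _)]

end Resolvent

/-! ### The idempotent deforming the projection -/

section Idempotent

open PowerSeries

variable {m n : ℕ} {B : Type} [CommRing B]

lemma mul_proj_inr (A : Mat m n B) (a : Idx m n) (b : Fin (2 * n + 1)) :
    (A * proj m n B) a (.inr b) = A a (.inr b) := by
  simp [proj, Matrix.mul_apply, Matrix.one_apply]

lemma mul_proj_inl (A : Mat m n B) (a : Idx m n) (b : Fin m ⊕ Fin m) :
    (A * proj m n B) a (.inl b) = 0 := by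
  simp [proj, Matrix.mul_apply]

lemma proj_mul_inr (A : Mat m n B) (a : Fin (2 * n + 1)) (b : Idx m n) :
    (proj m n B * A) (.inr a) b = A (.inr a) b := by
  simp [proj, Matrix.mul_apply, Matrix.one_apply]

lemma proj_mul_inl (A : Mat m n B) (a : Fin m ⊕ Fin m) (b : Idx m n) :
    (proj m n B * A) (.inl a) b = 0 := by
  simp [proj, Matrix.mul_apply]

lemma isIdempotentElem_proj : IsIdempotentElem (proj m n B) := by
  simp [IsIdempotentElem, proj, fromBlocks_multiply]

lemma map_proj {B' : Type} [CommRing B'] (φ : B →+* B') :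
    φ.mapMatrix (proj m n B) = proj m n B' := by
  simp [proj, fromBlocks_map, Matrix.map_zero, Matrix.map_one]

section Coefficients

variable {I : Type*}

lemma map_coeff_one_mul [Fintype I] (S T : Matrix I I B⟦X⟧) :
    (S * T).map (coeff 1) =
      S.map (coeff 0) * T.map (coeff 1) + S.map (coeff 1) * T.map (coeff 0) := by
  ext1 a b
  simp [Matrix.mul_apply, coeff_mul, Finset.Nat.antidiagonal_succ, Finset.sum_add_distrib]

lemma map_coeff_two_mul [Fintype I] (S T : Matrix I I B⟦X⟧) :
    (S * T).map (coeff 2) = S.map (coeff 0) * T.map (coeff 2) + S.map (coeff 1) * T.map (coeff 1) +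
      S.map (coeff 2) * T.map (coeff 0) := by
  ext1 a b
  simp [Matrix.mul_apply, coeff_mul, Finset.Nat.antidiagonal_succ, Finset.sum_add_distrib,
    add_assoc]

lemma map_coeff_zero_map_C_add (S A : Matrix I I B) :
    (S.map C + (X : B⟦X⟧) • A.map C).map (coeff 0) = S := by
  ext1 a b
  simp

lemma map_coeff_one_map_C_add (S A : Matrix I I B) :
    (S.map C + (X : B⟦X⟧) • A.map C).map (coeff 1) = A := by
  ext1 a b
  simp

lemma map_coeff_one_comm [Fintype I] {D : B → B} {W T : Matrix I I B⟦X⟧}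
    (hT : (T.map (coeff 0)).map D = 0)
    (hD : (X : B⟦X⟧) • T.map (coeffwise D) + (W * T - T * W) = 0) :
    (W * T).map (coeff 1) = (T * W).map (coeff 1) := by
  ext1 a b
  have hab := congrArg (coeff 1) (congrFun₂ hD a b)
  have hTab : D (coeff 0 (T a b)) = 0 := congrFun₂ hT a b
  rw [Matrix.add_apply, map_add, Matrix.sub_apply, map_sub, Matrix.smul_apply, smul_eq_mul,
    coeff_succ_X_mul, Matrix.map_apply, coeff_coeffwise, hTab, zero_add, Matrix.zero_apply,
    map_zero, sub_eq_zero] at hab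
  exact hab

end Coefficients

variable {T : Mat m n B⟦X⟧}

lemma coeff_one_of_isIdempotentElem (hT : IsIdempotentElem T) (hT₀ : T.map (coeff 0) = proj m n B)
    (a b : Fin (2 * n + 1)) : coeff 1 (T (.inr a) (.inr b)) = 0 := by
  have h := congrFun₂ (map_coeff_one_mul T T) (.inr a) (.inr b)
  rw [hT.eq, hT₀, Matrix.add_apply, proj_mul_inr, mul_proj_inr, left_eq_add] at h
  exact h

lemma coeff_two_of_isIdempotentElem (hT : IsIdempotentElem T) (hT₀ : T.map (coeff 0) = proj m n B)
    (a b : Fin (2 * n + 1)) : coeff 2 (T (.inr a) (.inr b)) =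
      -∑ i, coeff 1 (T (.inr a) (.inl i)) * coeff 1 (T (.inl i) (.inr b)) := by
  have h := congrFun₂ (map_coeff_two_mul T T) (.inr a) (.inr b)
  rw [hT.eq, hT₀, Matrix.add_apply, Matrix.add_apply, proj_mul_inr, mul_proj_inr, Matrix.mul_apply,
    Fintype.sum_sum_type] at h
  simp only [Matrix.map_apply, coeff_one_of_isIdempotentElem hT hT₀, mul_zero,
    Finset.sum_const_zero, add_zero] at h
  linear_combination -h

lemma coeff_two_of_commutator_eq_zero {D : B → B} {A : Mat m n B} (hT : IsIdempotentElem T)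
    (hT₀ : T.map (coeff 0) = proj m n B) (hproj : (proj m n B).map D = 0)
    (hD : (X : B⟦X⟧) • T.map (coeffwise D) +
      (((single (.inr 0) (.inr (Fin.last _)) 1 : Mat m n B).map C + (X : B⟦X⟧) • A.map C) * T -
        T * ((single (.inr 0) (.inr (Fin.last _)) 1 : Mat m n B).map C +
          (X : B⟦X⟧) • A.map C)) = 0) :
    coeff 2 (T (.inr (Fin.last _)) (.inr 0)) =
      -∑ i, A (.inr 0) (.inl i) * A (.inl i) (.inr (Fin.last _)) := by
  have hcomm := map_coeff_one_comm (hT₀ ▸ hproj) hD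
  rw [map_coeff_one_mul, map_coeff_one_mul, map_coeff_zero_map_C_add, map_coeff_one_map_C_add,
    hT₀] at hcomm
  have hrow (i) : coeff 1 (T (.inr (Fin.last _)) (.inl i)) = A (.inr 0) (.inl i) := by
    have h := congrFun₂ hcomm (.inr 0) (.inl i)
    rwa [Matrix.add_apply, Matrix.add_apply, mul_single_apply_of_ne _ _ _ _ _ (by simp),
      mul_proj_inl, proj_mul_inr, single_mul_apply_same, one_mul, add_zero, add_zero] at h
  have hcol (i) : coeff 1 (T (.inl i) (.inr 0)) = A (.inl i) (.inr (Fin.last _)) := by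
    have h := congrFun₂ hcomm (.inl i) (.inr (Fin.last _))
    rw [Matrix.add_apply, Matrix.add_apply, single_mul_apply_of_ne _ _ _ _ _ (by simp),
      mul_proj_inr, proj_mul_inl, mul_single_apply_same, mul_one, zero_add, zero_add] at h
    exact h.symm
  simp only [coeff_two_of_isIdempotentElem hT hT₀, hrow, hcol]

end Idempotent

section Pairing

variable {m n : ℕ} {B : Type} [CommRing B] (q r : Fin m → B) (u : Fin n → B) (i : Fin m)

lemma potential_inl_inl_last : potential q r u (.inl (.inl i)) (.inr (Fin.last _)) = q i := by
  simp [potential, genMu, genNu, genOmega, Matrix.sum_apply, Matrix.single_apply]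

lemma potential_inl_inr_last :
    potential q r u (.inl (.inr i)) (.inr (Fin.last _)) = (-1) ^ n * r i.rev := by
  simp [potential, genMu, genNu, genOmega, Matrix.sum_apply, Matrix.single_apply, mul_comm]

lemma potential_zero_inl_inl : potential q r u (.inr 0) (.inl (.inl i)) = -r i := by
  simp [potential, genMu, genNu, genOmega, Matrix.sum_apply, Matrix.single_apply, Fin.rev_eq_iff]

lemma potential_zero_inl_inr :
    potential q r u (.inr 0) (.inl (.inr i)) = (-1) ^ (n + 1) * q i.rev := by
  simp [potential, genMu, genNu, genOmega, Matrix.sum_apply, Matrix.single_apply, Fin.rev_eq_iff,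
    mul_comm]

lemma neg_sum_potential_mul_potential :
    -∑ i, potential q r u (.inr 0) (.inl i) * potential q r u (.inl i) (.inr (Fin.last _)) =
      2 * ∑ i, q i * r i := by
  have hsign : (-1 : B) ^ n * (-1) ^ n = 1 := by rw [← mul_pow]; simp
  have hrev : ∑ i : Fin m, q i.rev * r i.rev = ∑ i, q i * r i :=
    Equiv.sum_comp Fin.revPerm fun i => q i * r i
  have hsecond (i : Fin m) :
      (-1) ^ (n + 1) * q i.rev * ((-1) ^ n * r i.rev) = -(q i.rev * r i.rev) := by
    linear_combination (-q i.rev * r i.rev) * hsign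
  simp only [Fintype.sum_sum_type, potential_inl_inl_last, potential_inl_inr_last,
    potential_zero_inl_inl, potential_zero_inl_inr, hsecond, Finset.sum_neg_distrib, hrev,
    neg_mul, mul_comm (r _)]
  ring

end Pairing

section Projection

variable {m n : ℕ}

lemma proj_apply_ne {R : Type} [CommRing R] {a b : Idx m n} (hab : a ≠ b) :
    proj m n R a b = 0 := by
  rcases a with a | a <;> rcases b with b | b
  iterate 3 rfl
  exact Matrix.one_apply_ne (mt (congrArg Sum.inr) hab)

lemma principal_proj : principal (proj m n LFun) = proj m n LFun := by
  ext1 a b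
  have hsubst : subst n (proj m n LFun a b) = proj m n LFun a b :=
    congrFun₂ (map_proj (subst n)) a b
  rw [principal_apply, hsubst]
  rcases eq_or_ne a b with rfl | hab
  · rw [sub_self, lamPow_zero, one_mul]
  · rw [proj_apply_ne hab, mul_zero]

lemma principal_smul (c : LFun) (A : Mat m n LFun) :
    principal (c • A) = subst n c • principal A := by
  ext1 a b
  simp only [principal_apply, Matrix.smul_apply, smul_eq_mul, map_mul, mul_left_comm]

lemma JL_pow_card : JL m n ^ (2 * n + 1) = lamPow (-1) • proj m n LFun := by
  have hpow : (lamPow (-1) • cyc m n LFun) ^ (2 * n + 1) =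
      lamPow (-1) ^ (2 * n + 1) • cyc m n LFun ^ (2 * n + 1) := by
    simpa only [one_mul, mul_one] using
      mul_smul_pow_mul (lamPow (-1)) 1 (cyc m n LFun) 1 (2 * n + 1)
  refine principal_injective ?_
  rw [map_pow, principal_JL, hpow, cyc_pow_card, lamPow_pow, principal_smul, subst_lamPow,
    principal_proj]

lemma JL_mul_proj : JL m n * proj m n LFun = proj m n LFun * JL m n := by
  ext1 a b
  rcases a with a | a <;> rcases b with b | b
  · rw [mul_proj_inl, proj_mul_inl]
  · rw [mul_proj_inr, proj_mul_inl, JL_eq]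
    simp [bMat]
  · rw [mul_proj_inl, proj_mul_inr, JL_eq]
    simp [bMat]
  · rw [mul_proj_inr, proj_mul_inr]

lemma mapMatrix_ofSeries_add_X_smul (A : Mat m n Fun) :
    ofSeries.mapMatrix ((single (.inr 0) (.inr (Fin.last _)) 1 : Mat m n Fun).map PowerSeries.C +
      (PowerSeries.X : PowerSeries Fun) • (bMat m n Fun + A).map PowerSeries.C) =
    lamPow 1 • (JL m n + A.map ofFun) := by
  ext1 a b
  have hsingle : ofFun ((single (.inr 0) (.inr (Fin.last _)) 1 : Mat m n Fun) a b) =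
      lamPow 1 * (single (.inr 0) (.inr (Fin.last _)) (lamPow (-1)) : Mat m n LFun) a b := by
    rw [Matrix.single_apply, Matrix.single_apply, apply_ite ofFun, mul_ite, lamPow_mul,
      add_neg_cancel, lamPow_zero, map_one, map_zero, mul_zero]
  simp only [JL_eq, RingHom.mapMatrix_apply, Matrix.map_apply, Matrix.add_apply, Matrix.smul_apply,
    smul_eq_mul, map_add, map_mul, ofSeries_C, ofSeries_X, hsingle, mul_add, add_assoc]

lemma IsGauge.commute_proj {Δ : Mat m n Fun} (hΔ : IsGauge Δ) : Commute Δ (proj m n Fun) := by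
  obtain ⟨D, rfl, -, -⟩ := hΔ
  simp [Commute, SemiconjBy, proj, fromBlocks_multiply]

variable {v : Fields m n} {Δ : Mat m n Fun} {H : Mat m n LFun}

lemma IsDressing.map_coeffwise_conj_proj (h : IsDressing v Δ H) {η : (Mat m n (PowerSeries Fun))ˣ}
    (hη : ofSeries.mapMatrix ↑η = H) (hη' : ofSeries.mapMatrix ↑η⁻¹ = H⁻¹)
    {W : Mat m n (PowerSeries Fun)}
    (hW : ofSeries.mapMatrix W = lamPow 1 • (JL m n + v.toMat.map ofFun)) :
    (PowerSeries.X : PowerSeries Fun) •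
        (η.val * proj m n _ * η⁻¹.val).map (coeffwise (dt 0)) +
      (W * (η.val * proj m n _ * η⁻¹.val) - η.val * proj m n _ * η⁻¹.val * W) = 0 := by
  have hproj : (proj m n LFun).map (dtL 0) = 0 := by
    rw [← map_proj ofLoop]
    exact map_dtL_ofLoop 0 _
  refine map_coeffwise_add_commutator_eq_zero hW ?_
  rw [map_mul, map_mul, hη, hη', map_proj]
  exact map_dtL_conj_of_dressing 0 h.mul_inv h.map_dtL JL_mul_proj hproj

lemma IsGauge.map_coeff_zero_conj_proj (hΔ : IsGauge Δ) {η : (Mat m n (PowerSeries Fun))ˣ}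
    (hη : η.val.map PowerSeries.constantCoeff = Δ) :
    (η.val * proj m n _ * η⁻¹.val).map (PowerSeries.coeff 0) = proj m n Fun := by
  have hinv : Δ * PowerSeries.constantCoeff.mapMatrix η⁻¹.val = 1 := by
    rw [← hη, ← RingHom.mapMatrix_apply, ← map_mul, η.mul_inv, map_one]
  have hcoeff (A : Mat m n (PowerSeries Fun)) :
      A.map (PowerSeries.coeff 0) = PowerSeries.constantCoeff.mapMatrix A := by
    ext1 a b
    exact PowerSeries.coeff_zero_eq_constantCoeff_apply _
  rw [hcoeff, map_mul, map_mul, map_proj, RingHom.mapMatrix_apply _ η.val, hη,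
    hΔ.commute_proj.eq, mul_assoc, hinv, mul_one]

lemma map_dt_proj : (proj m n Fun).map (dt 0) = 0 := by
  rw [← map_proj (algebraMap ℂ Fun)]
  ext1 a b
  exact (MvPowerSeries.pderiv ℂ 0).map_algebraMap _

lemma coeff_two_conj_proj (h : IsDressing v Δ H) {η : (Mat m n (PowerSeries Fun))ˣ}
    (hη : ofSeries.mapMatrix ↑η = H) (hη' : ofSeries.mapMatrix ↑η⁻¹ = H⁻¹)
    (hη₀ : η.val.map PowerSeries.constantCoeff = Δ) :
    PowerSeries.coeff 2 ((η.val * proj m n (PowerSeries Fun) * η⁻¹.val)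
      (.inr (Fin.last _)) (.inr 0)) = 2 * ∑ i, v.q i * v.r i := by
  have hT : IsIdempotentElem (η.val * proj m n _ * η⁻¹.val) := by
    rw [IsIdempotentElem, ← pow_two, Units.conj_pow, pow_two, isIdempotentElem_proj.eq]
  have hb (i) : (bMat m n Fun + v.toMat) (.inr 0) (.inl i) = v.toMat (.inr 0) (.inl i) := by
    simp [bMat]
  have hb' (i) : (bMat m n Fun + v.toMat) (.inl i) (.inr (Fin.last _)) =
      v.toMat (.inl i) (.inr (Fin.last _)) := by
    simp [bMat]
  rw [coeff_two_of_commutator_eq_zero hT (h.gauge.map_coeff_zero_conj_proj hη₀) map_dt_proj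
    (h.map_coeffwise_conj_proj hη hη' (mapMatrix_ofSeries_add_X_smul _))]
  simp only [hb, hb']
  rw [toMat_eq_potential, neg_sum_potential_mul_potential]

variable {f : Mat m n (LaurentSeries ℂ)} {M E : Mat m n LFun} {τ : Fun}

theorem IsTau.logTau₂_card (h : IsTau f M E τ) (hv : IsAttached M v) :
    logTau₂ τ 0 n = 2 * ∑ i, v.q i * v.r i := by
  obtain ⟨Δ, H, hH, htau⟩ := h.exists_isDressing hv
  obtain ⟨η, hη, hη', hη₀⟩ := hH.exists_units
  have hconj : H * (lamPow (-1) • proj m n LFun) * H⁻¹ =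
      lamPow (-1) • ofSeries.mapMatrix (η.val * proj m n _ * η⁻¹.val) := by
    rw [map_mul, map_mul, hη, hη', map_proj]
    simpa only [pow_one] using mul_smul_pow_mul (lamPow (-1)) H (proj m n LFun) H⁻¹ 1
  rw [htau, JL_pow_card, hconj, ← coeff_two_conj_proj hH hη hη' hη₀, ← coeffLam_ofSeries,
    Matrix.smul_apply, smul_eq_mul, coeffLam_lamPow_mul]
  rfl

end Projection

section Evaluation

open MvPolynomial

variable {m n : ℕ}

lemma evalDiff_dPoly (v : Fields m n) (P : MvPolynomial (Letter m n) ℂ) :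
    evalDiff v (dPoly P) = dt 0 (evalDiff v P) := by
  have hconst (c : ℂ) : dt 0 (algebraMap ℂ Fun c) = 0 :=
    (MvPowerSeries.pderiv ℂ 0).map_algebraMap c
  have hadd (a b : Fun) : dt 0 (a + b) = dt 0 a + dt 0 b := map_add _ a b
  have hmul (a b : Fun) : dt 0 (a * b) = a * dt 0 b + b * dt 0 a :=
    (MvPowerSeries.pderiv ℂ 0).leibniz a b
  simp only [evalDiff]
  induction P using MvPolynomial.induction_on with
  | C c => rw [← algebraMap_eq, Derivation.map_algebraMap, map_zero, AlgHom.commutes, hconst]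
  | add p q hp hq => rw [map_add, map_add, map_add, hp, hq, hadd]
  | mul_X p l hp =>
    rw [Derivation.leibniz, map_add, smul_eq_mul, smul_eq_mul, map_mul, map_mul, map_mul, hp,
      dPoly_X, aeval_X, aeval_X, hmul]
    congr 2
    cases l <;> exact Function.iterate_succ_apply' _ _ _

lemma map_aeval_genericPotential (v : Fields m n) :
    (aeval (R := ℂ) (Letter.val v)).toRingHom.mapMatrix (genericPotential m n) = v.toMat := by
  rw [map_genericPotential, toMat_eq_potential]
  congr 1 <;> funext i <;> exact aeval_X _ _

theorem IsTau.logTau₂_eq_evalDiff {f : Mat m n (LaurentSeries ℂ)} {M E : Mat m n LFun} {τ : Fun}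
    {v : Fields m n} (h : IsTau f M E τ) (hv : IsAttached M v) (k : ℕ) :
    logTau₂ τ 0 k = evalDiff v (tauPoly m n k) := by
  obtain ⟨σ, hσ₀, hσ, hD, htau⟩ := h.exists_resolventSeries hv
  rw [← map_aeval_genericPotential] at hD
  rw [htau, ← map_tauPoly _ (evalDiff_dPoly v) hσ₀ hσ hD]
  rfl

lemma evalDiff_sub_C_mul_X_u (v : Fields m n) (P : MvPolynomial (Letter m n) ℂ) (c : ℂ)
    (j : Fin n) : evalDiff v (P - C c * X (.u j 0)) = evalDiff v P - c • v.u j := by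
  rw [evalDiff, map_sub, map_mul, aeval_X, aeval_C, Algebra.smul_def]
  rfl

lemma qrOrderLE_tauPoly (j : ℕ) : QROrderLE (2 * j) (tauPoly m n (n + j)) := by
  refine qrOrderLE_of_isWeightedHomogeneous ?_
  rw [show 2 * n + 2 + 2 * j = 2 * (n + j) + 2 by ring]
  exact isWeightedHomogeneous_tauPoly _

/-- The differential polynomial `2 ∑ qᵢ rᵢ`, a `u`-free expression of `(ln τ)_{t₁ t_{2n+1}}`. -/
def pairingPoly (m n : ℕ) : MvPolynomial (Letter m n) ℂ := C 2 * ∑ i, X (.q i 0) * X (.r i 0)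

lemma evalDiff_pairingPoly (v : Fields m n) :
    evalDiff v (pairingPoly m n) = 2 * ∑ i, v.q i * v.r i := by
  simp only [evalDiff, pairingPoly, map_mul, map_sum, aeval_X, map_ofNat, Letter.val,
    Function.iterate_zero, id_eq]

lemma eq_q_or_eq_r_of_mem_vars_pairingPoly {l : Letter m n} (hl : l ∈ (pairingPoly m n).vars) :
    ∃ i, l = .q i 0 ∨ l = .r i 0 := by
  classical
  have hsum := vars_mul _ _ hl
  rw [vars_C, Finset.empty_union] at hsum
  obtain ⟨i, -, hi⟩ := Finset.mem_biUnion.1 (vars_sum_subset _ _ hsum)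
  have hprod := vars_mul _ _ hi
  rw [vars_X, vars_X] at hprod
  exact ⟨i, by simpa using hprod⟩

lemma qrOrderLE_pairingPoly (d : ℕ) : QROrderLE d (pairingPoly m n) := by
  intro l hl i k hk
  obtain ⟨i', rfl | rfl⟩ := eq_q_or_eq_r_of_mem_vars_pairingPoly hl <;>
    rcases hk with hk | hk <;> cases hk <;> exact Nat.zero_le d

lemma involvesNoU_pairingPoly : InvolvesNoU (pairingPoly m n) := by
  rintro _ hl i k rfl
  obtain ⟨i', h | h⟩ := eq_q_or_eq_r_of_mem_vars_pairingPoly hl <;> cases h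

end Evaluation

end

end CCKP

theorem mainTheorem6 (m n : ℕ) :
    ∃ (R : Fin n → MvPolynomial (CCKP.Letter m n) ℂ) (K : ℕ → MvPolynomial (CCKP.Letter m n) ℂ),
      (∀ j : Fin n, CCKP.InvolvesOnlyULt (j : ℕ) (R j)) ∧
      (∀ j : ℕ, CCKP.QROrderLE (2 * j) (K j)) ∧
      CCKP.InvolvesNoU (K 0) ∧
      ∀ (f : CCKP.Mat m n (LaurentSeries ℂ)) (M E : CCKP.Mat m n CCKP.LFun) (τ : CCKP.Fun)
        (v : CCKP.Fields m n),
        CCKP.IsTau f M E τ → CCKP.IsAttached M v → CCKP.IsSolution v →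
          (∀ j : Fin n, CCKP.logTau₂ τ 0 j =
            ((2 * (2 * (j : ℂ) + 1)) / (2 * (n : ℂ) + 1)) • v.u j + CCKP.evalDiff v (R j)) ∧
          (∀ j : ℕ, CCKP.logTau₂ τ 0 (n + j) = CCKP.evalDiff v (K j)) := by
  refine ⟨fun j => CCKP.tauPoly m n j -
      MvPolynomial.C (2 * (2 * (j : ℂ) + 1) / (2 * (n : ℂ) + 1)) * MvPolynomial.X (.u j 0),
    fun | 0 => CCKP.pairingPoly m n | j + 1 => CCKP.tauPoly m n (n + (j + 1)),
    fun j => ?_, fun j => ?_, CCKP.involvesNoU_pairingPoly,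
    fun f M E τ v hτ hv _ => ⟨fun j => ?_, fun j => ?_⟩⟩
  · simpa only [CCKP.coeff_tauPoly j] using
      CCKP.involvesOnlyULt_sub_C_mul_X (CCKP.isWeightedHomogeneous_tauPoly j)
  · cases j with
    | zero => exact CCKP.qrOrderLE_pairingPoly _
    | succ j => exact CCKP.qrOrderLE_tauPoly (j + 1)
  · rw [hτ.logTau₂_eq_evalDiff hv, CCKP.evalDiff_sub_C_mul_X_u, add_sub_cancel]
  · cases j with
    | zero => exact (hτ.logTau₂_card hv).trans (CCKP.evalDiff_pairingPoly v).symm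
    | succ j => exact hτ.logTau₂_eq_evalDiff hv _
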